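/- For finite sequences of real numbers $A=(a_1,\dots,a_N)$ and $B=(b_1,\dots,b_N)$ of the same length, write $A\vartriangleright B$ ("$A$ majorizes $B$") if $a_{(1)}+\dots+a_{(j)}\ge b_{(1)}+\dots+b_{(j)}$ for all $j=1,\dots,N$, where $a_{(1)}\le\dots\le a_{(N)}$ and $b_{(1)}\le\dots\le b_{(N)}$ are the nondecreasing rearrangements. For $s\in\mathbb R$ and points $x\neq y$ of $\mathbb R^n$ let $r_s(x,y)=\|x-y\|^s$ if $s>0$, $r_0(x,y)=\log\|x-y\|$, and $r_s(x,y)=-\|x-y\|^s$ if $s<0$. For a finite set $X$ let $R_s(X)$ be the family (with multiplicities) of the values $r_s(x,y)$ over all unordered pairs of distinct points of $X$. For $S\subset\mathbb R^n$, $q>0$ and $m\in\mathbb N$ let $\Omega(S,q,m)$ be the set of all $m$-point subsets of $S$ whose distinct points are at distance at least $q$, and let $M(S,r_s,q,m)$ be the set of all $X\in\Omega(S,q,m)$ such that for every $Y\in\Omega(S,q,m)$ either $R_s(X)\vartriangleright R_s(Y)$, or $R_s(X)$ and $R_s(Y)$ are incomparable (neither majorizes the other). Let $\mathbb B^n$ and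 $\mathbb S^{n-1}$ be the closed unit ball and the unit sphere of $\mathbb R^n$. **Theorem.** Let $2\le k\le n$ be integers and let $s\le 2$. Then $$M(\mathbb B^{n},r_s,\sqrt2,n+k)=M(\mathbb S^{n-1},r_s,\sqrt2,n+k),$$ this set is non-empty, and each of its elements is the union of the vertex sets of $k$ mutually orthogonal regular $d_i$-simplices $S_1,\dots,S_k$ with all $d_i\ge1$ and $d_1+\dots+d_k=n$; that is, there are mutually orthogonal linear subspaces $L_1,\dots,L_k$ of $\mathbb R^n$ with $\dim L_i=d_i$ such that $S_i$ is a regular $d_i$-simplex inscribed in the unit sphere of $L_i$. If moreover $-2\le s\le 2$, then conversely every such union belongs to $M(\mathbb S^{n-1},r_s,\sqrt2,n+k)$. -/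

import Mathlib

noncomputable section

open scoped InnerProductSpace

/-- Weak majorization of finite sequences of reals (given as multisets, since only the
nondecreasing rearrangement matters): the sequences have the same length `N` and, for every
`1 ≤ j ≤ N`, the sum of the `j` smallest terms of `A` is at least that of `B`. -/
def Majorizes (A B : Multiset ℝ) : Prop :=
  A.card = B.card ∧
    ∀ j : ℕ, 1 ≤ j → j ≤ A.card → (B.sort.take j).sum ≤ (A.sort.take j).sum

/-- Symmetric real functions of two variables. -/
abbrev SymmFun (E : Type*) := {f : E → E → ℝ // ∀ a b, f a b = f b a}

/-- The family of values `ρ(x, y)` over the unordered pairs of distinct elements of `X`,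
with multiplicities. -/
def pairValues {E : Type*} [DecidableEq E] (ρ : SymmFun E) (X : Finset E) : Multiset ℝ :=
  (X.sym2.filter fun e => ¬ e.IsDiag).val.map (Sym2.lift ρ)

/-- The `m`-point subsets of `S` whose distinct points have distance at least `q`. -/
def constrainedSets {E : Type*} [MetricSpace E] (S : Set E) (q : ℝ) (m : ℕ) : Set (Finset E) :=
  {X | (X : Set E) ⊆ S ∧ X.card = m ∧ ∀ x ∈ X, ∀ y ∈ X, x ≠ y → q ≤ dist x y}

/-- The `M`-sets: those admissible `X` such that for each admissible `Y` either `X` majorizes `Y`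
or the two are incomparable. -/
def MSets {E : Type*} [MetricSpace E] [DecidableEq E] (S : Set E) (ρ : SymmFun E) (q : ℝ)
    (m : ℕ) : Set (Finset E) :=
  {X | X ∈ constrainedSets S q m ∧ ∀ Y ∈ constrainedSets S q m,
    Majorizes (pairValues ρ X) (pairValues ρ Y) ∨
      (¬ Majorizes (pairValues ρ X) (pairValues ρ Y) ∧
        ¬ Majorizes (pairValues ρ Y) (pairValues ρ X))}

/-- The function `r_s`: `r ^ s` for `s > 0`, `log r` for `s = 0`, `- r ^ s` for `s < 0`,
where `r` is the distance. -/
def rieszFun {E : Type*} [MetricSpace E] (s : ℝ) : SymmFun E :=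
  ⟨fun x y => if 0 < s then dist x y ^ s else if s = 0 then Real.log (dist x y)
    else - dist x y ^ s, fun a b => by simp only [dist_comm a b]⟩

/-- `S` is the vertex set of a regular `d`-simplex. -/
def IsRegularSimplex {E : Type*} [NormedAddCommGroup E] [NormedSpace ℝ E] (d : ℕ)
    (S : Finset E) : Prop :=
  ∃ σ : Affine.Simplex ℝ E d, σ.Equilateral ∧ Set.range σ.points = (S : Set E)

/-- `X` is the union of `k` mutually orthogonal regular simplices of dimensions `d i ≥ 1` with
`∑ d i = n`: there are mutually orthogonal linear subspaces `L i` of dimensions `d i`, and `X` is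
the union of the vertex sets `S i` of regular `d i`-simplices, `S i` being inscribed in the unit
sphere of `L i`. -/
def IsOrthogonalSimplexUnion {E : Type*} [NormedAddCommGroup E] [InnerProductSpace ℝ E]
    (n k : ℕ) (X : Finset E) : Prop :=
  ∃ (d : Fin k → ℕ) (L : Fin k → Submodule ℝ E) (S : Fin k → Finset E),
    (∀ i, 1 ≤ d i) ∧ ∑ i, d i = n ∧
    (∀ i, Module.finrank ℝ (L i) = d i) ∧
    (∀ i j, i ≠ j → L i ⟂ L j) ∧
    (∀ i, IsRegularSimplex (d i) (S i)) ∧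
    (∀ i, ∀ x ∈ S i, x ∈ L i ∧ ‖x‖ = 1) ∧
    (X : Set E) = ⋃ i, (S i : Set E)

end

/-!
Points of the unit ball at mutual distances at least `√2` have pairwise nonpositive inner products.
A minimal linearly dependent set of such points has a dependency with positive coefficients, so it
is orthogonal to all the other points. Splitting off such circuits, `n + k` points fall into `k`
mutually orthogonal blocks of `d i + 1` points each, with `∑ d i = n`.

Compare the squared distances `t` with the squared distances `δ` of the orthogonal regular simplices
of dimensions `d i`. The sum of `δ - t` over the ordered pairs of a block is
`2 (d + 1) ∑ (1 - ‖v j‖²) + 2 ‖∑ v j‖² ≥ 0`, and `δ - t ≥ 0` for two points of different blocks, so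
weighted sums of `δ - t` are nonnegative whenever the weight is a nonnegative function of `δ`. For
`s ≤ 2` the kernel `r_s` is an increasing concave function of the squared distance, and its tangent
lines turn these weighted sums into majorization, with equality only for regular simplices.

Hence the `M`-sets, of the ball as of the sphere, are the simplex unions that are maximal among the
simplex unions. Their value families depend only on `d`, so there are finitely many and a maximal
one exists. For `-2 ≤ s ≤ 2` all of them are maximal: neither `∑ t` nor `∑ 1 / t` depends on `d`,
while `-16 / t - t` is a strictly concave, nondecreasing function of `r_s` on `2 ≤ t ≤ 4`, so the
equality case of the Tomić–Weyl inequality shows that comparable value families coincide.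
-/

open scoped InnerProductSpace

section Majorization

/-- The `i`-th smallest term of a multiset of reals, counted from `0`, as in the nondecreasing
rearrangement that defines majorization; the junk value for `A.card ≤ i` is `0`. -/
noncomputable def orderStat (A : Multiset ℝ) (i : ℕ) : ℝ := A.sort.getD i 0

variable {A B : Multiset ℝ} {I : Set ℝ}

theorem orderStat_eq_getElem {i : ℕ} (hi : i < A.card) :
    orderStat A i = A.sort[i]'(by simpa using hi) :=
  List.getD_eq_getElem _ _ _

theorem orderStat_mem {i : ℕ} (hi : i < A.card) : orderStat A i ∈ A := by
  rw [orderStat_eq_getElem hi, ← Multiset.mem_sort (r := (· ≤ ·))]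
  exact List.getElem_mem _

theorem orderStat_le_orderStat {i j : ℕ} (hij : i ≤ j) (hj : j < A.card) :
    orderStat A i ≤ orderStat A j := by
  rw [orderStat_eq_getElem (hij.trans_lt hj), orderStat_eq_getElem hj]
  exact (A.pairwise_sort (· ≤ ·)).rel_get_of_le (a := ⟨i, _⟩) (b := ⟨j, _⟩) hij

theorem sum_take_sort (A : Multiset ℝ) (j : ℕ) :
    (A.sort.take j).sum = ∑ i ∈ Finset.range j, orderStat A i := by
  induction j with
  | zero => simp
  | succ j ih =>
    rw [List.take_add_one, List.sum_append, ih, Finset.sum_range_succ, orderStat,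
      List.getD_eq_getElem?_getD]
    cases A.sort[j]? <;> simp

theorem map_orderStat_range (A : Multiset ℝ) :
    (Multiset.range A.card).map (orderStat A) = A := by
  conv_rhs => rw [← A.sort_eq (· ≤ ·)]
  rw [Multiset.range, Multiset.map_coe, Multiset.coe_eq_coe]
  refine .of_eq (List.ext_getElem (by simp) fun i hi _ => ?_)
  rw [List.getElem_map, List.getElem_range, orderStat_eq_getElem (by simpa using hi)]

theorem sum_map_eq_sum_orderStat (A : Multiset ℝ) (f : ℝ → ℝ) :
    (A.map f).sum = ∑ i ∈ Finset.range A.card, f (orderStat A i) := by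
  conv_lhs => rw [← map_orderStat_range A, Multiset.map_map]
  rfl

theorem eq_of_orderStat_eq (hc : A.card = B.card)
    (h : ∀ i < A.card, orderStat A i = orderStat B i) : A = B := by
  rw [← map_orderStat_range A, ← map_orderStat_range B, ← hc]
  exact Multiset.map_congr rfl fun i hi => h i (Multiset.mem_range.1 hi)

theorem orderStat_map {φ : ℝ → ℝ} (hφ : StrictMonoOn φ I) (hA : ∀ a ∈ A, a ∈ I) {i : ℕ}
    (hi : i < A.card) : orderStat (A.map φ) i = φ (orderStat A i) := by
  have hsort : (A.map φ).sort = A.sort.map φ :=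
    (Multiset.map_sort φ A (· ≤ ·) (· ≤ ·)
      fun a ha b hb => (hφ.le_iff_le (hA a ha) (hA b hb)).symm).symm
  rw [orderStat_eq_getElem (by simpa using hi), orderStat_eq_getElem hi]
  simp only [hsort, List.getElem_map]

theorem majorizes_iff : Majorizes A B ↔ A.card = B.card ∧ ∀ j ≤ A.card,
    ∑ i ∈ Finset.range j, orderStat B i ≤ ∑ i ∈ Finset.range j, orderStat A i := by
  simp only [Majorizes, sum_take_sort]
  refine and_congr_right fun _ => forall_congr' fun j => ?_
  rcases j.eq_zero_or_pos with rfl | hj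
  · simp
  · simp [Nat.succ_le_iff, hj]

theorem Majorizes.refl (A : Multiset ℝ) : Majorizes A A := ⟨rfl, fun _ _ _ => le_rfl⟩

theorem Majorizes.trans {C : Multiset ℝ} (hAB : Majorizes A B) (hBC : Majorizes B C) :
    Majorizes A C :=
  ⟨hAB.1.trans hBC.1, fun j hj hjA => (hBC.2 j hj (hAB.1 ▸ hjA)).trans (hAB.2 j hj hjA)⟩

theorem Majorizes.antisymm (hAB : Majorizes A B) (hBA : Majorizes B A) : A = B := by
  rw [majorizes_iff] at hAB hBA
  have hsum : ∀ j ≤ A.card,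
      ∑ i ∈ Finset.range j, orderStat A i = ∑ i ∈ Finset.range j, orderStat B i :=
    fun j hj => (hBA.2 j (hAB.1 ▸ hj)).antisymm (hAB.2 j hj)
  refine eq_of_orderStat_eq hAB.1 fun i hi => ?_
  have := hsum (i + 1) hi
  rwa [Finset.sum_range_succ, Finset.sum_range_succ, hsum i hi.le, add_right_inj] at this

theorem mul_sub_sum_orderStat_le (θ : ℝ) {j : ℕ} (hj : j ≤ A.card) :
    j * θ - ∑ i ∈ Finset.range j, orderStat A i ≤ (A.map fun a => max (θ - a) 0).sum :=
  calc j * θ - ∑ i ∈ Finset.range j, orderStat A i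
      = ∑ i ∈ Finset.range j, (θ - orderStat A i) := by simp
    _ ≤ ∑ i ∈ Finset.range j, max (θ - orderStat A i) 0 :=
      Finset.sum_le_sum fun _ _ => le_max_left _ _
    _ ≤ ∑ i ∈ Finset.range A.card, max (θ - orderStat A i) 0 :=
      Finset.sum_le_sum_of_subset_of_nonneg (Finset.range_mono hj) fun _ _ _ => le_max_right _ _
    _ = (A.map fun a => max (θ - a) 0).sum := by rw [sum_map_eq_sum_orderStat]

theorem sum_max_orderStat_sub {i : ℕ} (hi : i < A.card) :
    (A.map fun a => max (orderStat A i - a) 0).sum =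
      (i + 1 : ℕ) * orderStat A i - ∑ m ∈ Finset.range (i + 1), orderStat A m := by
  rw [sum_map_eq_sum_orderStat, ← Finset.sum_subset (Finset.range_mono hi)]
  · rw [Finset.sum_congr rfl fun m hm => max_eq_left (sub_nonneg.2
      (orderStat_le_orderStat (Nat.lt_succ_iff.1 (Finset.mem_range.1 hm)) hi))]
    simp
  · intro m hm hmi
    rw [Finset.mem_range] at hm hmi
    exact max_eq_right (sub_nonpos.2 (orderStat_le_orderStat (by omega) hm))

theorem majorizes_of_sum_max_le (hc : A.card = B.card)
    (h : ∀ θ : ℝ, (A.map fun a => max (θ - a) 0).sum ≤ (B.map fun a => max (θ - a) 0).sum) :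
    Majorizes A B := by
  refine majorizes_iff.2 ⟨hc, fun j hj => ?_⟩
  rcases j with _ | i
  · simp
  have hA := mul_sub_sum_orderStat_le (orderStat B i) hj
  have hB := sum_max_orderStat_sub (A := B) (i := i) (by omega)
  linarith [h (orderStat B i)]

theorem sum_mul_nonneg_of_antitone {N : ℕ} {D f : ℕ → ℝ}
    (hD : ∀ i, i + 1 < N → D (i + 1) ≤ D i) (hD₀ : ∀ i < N, 0 ≤ D i)
    (hf : ∀ j ≤ N, 0 ≤ ∑ i ∈ Finset.range j, f i) :
    0 ≤ ∑ i ∈ Finset.range N, D i * f i := by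
  have hpartial : ∀ m < N, D m * ∑ i ∈ Finset.range (m + 1), f i ≤
      ∑ i ∈ Finset.range (m + 1), D i * f i := by
    intro m
    induction m with
    | zero => simp
    | succ m ih =>
      intro hm
      have hstep := mul_le_mul_of_nonneg_right (hD m hm) (hf (m + 1) (by omega))
      rw [Finset.sum_range_succ, Finset.sum_range_succ (fun i => D i * f i), mul_add]
      linarith [ih (by omega)]
  rcases N with _ | m
  · simp
  · exact (mul_nonneg (hD₀ m m.lt_succ_self) (hf _ le_rfl)).trans (hpartial m m.lt_succ_self)

theorem antitoneOn_of_lt_add_mul_sub {φ ψ D : ℝ → ℝ} (hφ : StrictMonoOn φ I)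
    (hψ : ∀ a ∈ I, ∀ b ∈ I, a ≠ b → ψ b < ψ a + D a * (φ b - φ a)) : AntitoneOn D I := by
  intro a ha b hb hab
  rcases hab.eq_or_lt with rfl | hab
  · rfl
  have hsub : 0 < φ b - φ a := sub_pos.2 (hφ ha hb hab)
  have h₁ := hψ a ha b hb hab.ne
  have h₂ := hψ b hb a ha hab.ne'
  by_contra! hlt
  nlinarith

theorem Majorizes.sum_mul_sub_nonneg {φ D : ℝ → ℝ} (h : Majorizes (A.map φ) (B.map φ))
    (hφ : StrictMonoOn φ I) (hA : ∀ a ∈ A, a ∈ I) (hB : ∀ b ∈ B, b ∈ I) (hD : AntitoneOn D I)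
    (hD₀ : ∀ a ∈ I, 0 ≤ D a) :
    0 ≤ ∑ i ∈ Finset.range A.card,
      D (orderStat A i) * (φ (orderStat A i) - φ (orderStat B i)) := by
  obtain ⟨hc, hmaj⟩ := majorizes_iff.1 h
  simp only [Multiset.card_map] at hc hmaj
  have hAI : ∀ i < A.card, orderStat A i ∈ I := fun i hi => hA _ (orderStat_mem hi)
  refine sum_mul_nonneg_of_antitone
    (fun i hi => hD (hAI i (by omega)) (hAI _ hi) (orderStat_le_orderStat i.le_succ hi))
    (fun i hi => hD₀ _ (hAI i hi)) fun j hj => ?_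
  rw [Finset.sum_sub_distrib, sub_nonneg]
  convert hmaj j hj using 2 with i hi i hi
  all_goals
    rw [Finset.mem_range] at hi
    rw [orderStat_map hφ ‹_› (by omega)]

/-- Equality case of the Tomić–Weyl inequality: the hypotheses say that `ψ ∘ φ⁻¹` is strictly
concave with nonnegative supergradient `D ∘ φ⁻¹` on `φ '' I`. -/
theorem Majorizes.eq_of_sum_map_le {φ ψ D : ℝ → ℝ} (h : Majorizes (A.map φ) (B.map φ))
    (hφ : StrictMonoOn φ I) (hA : ∀ a ∈ A, a ∈ I) (hB : ∀ b ∈ B, b ∈ I)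
    (hD₀ : ∀ a ∈ I, 0 ≤ D a)
    (hψ : ∀ a ∈ I, ∀ b ∈ I, a ≠ b → ψ b < ψ a + D a * (φ b - φ a))
    (hsum : (A.map ψ).sum ≤ (B.map ψ).sum) : A = B := by
  have hc : A.card = B.card := by simpa using h.1
  have hAI : ∀ i < A.card, orderStat A i ∈ I := fun i hi => hA _ (orderStat_mem hi)
  have hBI : ∀ i < A.card, orderStat B i ∈ I := fun i hi => hB _ (orderStat_mem (hc ▸ hi))
  let gap (a b : ℝ) : ℝ := ψ a + D a * (φ b - φ a) - ψ b
  have gap_nonneg : ∀ i ∈ Finset.range A.card, 0 ≤ gap (orderStat A i) (orderStat B i) := by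
    intro i hi
    rw [Finset.mem_range] at hi
    rcases eq_or_ne (orderStat A i) (orderStat B i) with heq | hne
    · simp [gap, heq]
    · exact (sub_pos.2 (hψ _ (hAI i hi) _ (hBI i hi) hne)).le
  have sum_gap : ∑ i ∈ Finset.range A.card, gap (orderStat A i) (orderStat B i) ≤ 0 := by
    have hslope := h.sum_mul_sub_nonneg hφ hA hB (antitoneOn_of_lt_add_mul_sub hφ hψ) hD₀
    rw [sum_map_eq_sum_orderStat, sum_map_eq_sum_orderStat, ← hc] at hsum
    have hsplit : ∀ a b, gap a b = ψ a - ψ b - D a * (φ a - φ b) := fun a b => by ring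
    simp only [hsplit, Finset.sum_sub_distrib]
    linarith
  have gap_eq_zero := (Finset.sum_eq_zero_iff_of_nonneg gap_nonneg).1
    (sum_gap.antisymm (Finset.sum_nonneg gap_nonneg))
  refine eq_of_orderStat_eq hc fun i hi => ?_
  by_contra hne
  exact (sub_pos.2 (hψ _ (hAI i hi) _ (hBI i hi) hne)).ne' (gap_eq_zero i (Finset.mem_range.2 hi))

end Majorization

section WeightedComparison

variable {ι : Type*} {P : Finset ι} {δ t : ι → ℝ}

theorem majorizes_map_of_weighted_sum_nonneg {φ m : ℝ → ℝ}
    (hw : ∀ w : ℝ → ℝ, (∀ p ∈ P, 0 ≤ w (δ p)) → 0 ≤ ∑ p ∈ P, w (δ p) * (δ p - t p))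
    (hm : ∀ p ∈ P, 0 ≤ m (δ p)) (hφ : ∀ p ∈ P, φ (t p) ≤ φ (δ p) + m (δ p) * (t p - δ p)) :
    Majorizes ((P.val.map δ).map φ) ((P.val.map t).map φ) := by
  refine majorizes_of_sum_max_le (by simp) fun θ => ?_
  let w (c : ℝ) : ℝ := if φ c < θ then m c else 0
  have hwδ := hw w fun p hp => by dsimp only [w]; split_ifs; exacts [hm p hp, le_rfl]
  simp only [Multiset.map_map, Function.comp_def]
  change ∑ p ∈ P, max (θ - φ (δ p)) 0 ≤ ∑ p ∈ P, max (θ - φ (t p)) 0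
  suffices h : ∑ p ∈ P, (max (θ - φ (δ p)) 0 + w (δ p) * (δ p - t p)) ≤
      ∑ p ∈ P, max (θ - φ (t p)) 0 by
    rw [Finset.sum_add_distrib] at h
    linarith
  refine Finset.sum_le_sum fun p hp => ?_
  dsimp only [w]
  split_ifs with hθ
  · rw [max_eq_left (sub_pos.2 hθ).le]
    exact le_max_of_le_left (by linarith [hφ p hp])
  · rw [max_eq_right (sub_nonpos.2 (not_lt.1 hθ)), zero_mul, add_zero]
    exact le_max_right _ _

theorem eq_of_map_eq_of_weighted_sum_nonneg
    (hw : ∀ w : ℝ → ℝ, (∀ p ∈ P, 0 ≤ w (δ p)) → 0 ≤ ∑ p ∈ P, w (δ p) * (δ p - t p))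
    (h : P.val.map δ = P.val.map t) : ∀ p ∈ P, t p = δ p := by
  have hsum (f : ℝ → ℝ) : ∑ p ∈ P, f (δ p) = ∑ p ∈ P, f (t p) := by
    simpa using congrArg (fun A => (A.map f).sum) h
  obtain ⟨K, hK⟩ := (P.image δ).exists_le
  have hweight := hw (fun c => K - c) fun p hp =>
    sub_nonneg.2 (hK _ (Finset.mem_image_of_mem δ hp))
  have hexpand : ∑ p ∈ P, (K - δ p) * (δ p - t p) =
      K * (∑ p ∈ P, δ p - ∑ p ∈ P, t p) - (∑ p ∈ P, δ p ^ 2 - ∑ p ∈ P, δ p * t p) := by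
    rw [← Finset.sum_sub_distrib, ← Finset.sum_sub_distrib, Finset.mul_sum,
      ← Finset.sum_sub_distrib]
    exact Finset.sum_congr rfl fun p _ => by ring
  have hsq : ∑ p ∈ P, (t p - δ p) ^ 2 =
      ∑ p ∈ P, t p ^ 2 + ∑ p ∈ P, δ p ^ 2 - 2 * ∑ p ∈ P, δ p * t p := by
    rw [← Finset.sum_add_distrib, Finset.mul_sum, ← Finset.sum_sub_distrib]
    exact Finset.sum_congr rfl fun p _ => by ring
  have hle : ∑ p ∈ P, (t p - δ p) ^ 2 ≤ 0 := by
    have hδ := hsum id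
    have hδ₂ := hsum (· ^ 2)
    simp only [id] at hδ
    rw [hexpand, hδ, sub_self, mul_zero] at hweight
    linarith
  intro p hp
  have hzero := (Finset.sum_eq_zero_iff_of_nonneg fun p _ => sq_nonneg (t p - δ p)).1
    (hle.antisymm (Finset.sum_nonneg fun p _ => sq_nonneg _)) p hp
  exact sub_eq_zero.1 (pow_eq_zero_iff two_ne_zero |>.1 hzero)

end WeightedComparison

section RieszFunction

/-- The kernel `r_s` as a function of the squared distance. -/
noncomputable def rieszSq (s t : ℝ) : ℝ :=
  if 0 < s then t ^ (s / 2) else if s = 0 then Real.log t / 2 else -t ^ (s / 2)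

/-- The derivative of `rieszSq s` at `c > 0`, the slope of its tangent lines. -/
noncomputable def rieszSqSlope (s c : ℝ) : ℝ :=
  (if s = 0 then 1 / 2 else |s| / 2) * c ^ (s / 2 - 1)

theorem rieszFun_eq_rieszSq {E : Type*} [NormedAddCommGroup E] (s : ℝ) (x y : E) :
    (rieszFun s).1 x y = rieszSq s (‖x - y‖ ^ 2) := by
  have hpow : (‖x - y‖ ^ 2) ^ (s / 2) = ‖x - y‖ ^ s := by
    rw [← Real.rpow_natCast, ← Real.rpow_mul (norm_nonneg _), Nat.cast_two, mul_div_cancel₀]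
    exact two_ne_zero
  simp only [rieszFun, rieszSq, dist_eq_norm, hpow, Real.log_pow]
  congr 2
  push_cast
  ring

theorem rieszSqSlope_pos (s : ℝ) {c : ℝ} (hc : 0 < c) : 0 < rieszSqSlope s c := by
  unfold rieszSqSlope
  have := Real.rpow_pos_of_pos hc (s / 2 - 1)
  split_ifs with h <;> positivity

theorem rieszSq_inv (s : ℝ) {t : ℝ} (ht : 0 < t) : rieszSq s t⁻¹ = -rieszSq (-s) t := by
  have hpow : t⁻¹ ^ (s / 2) = t ^ (-s / 2) := by
    rw [Real.inv_rpow ht.le, ← Real.rpow_neg ht.le, neg_div]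
  rcases lt_trichotomy s 0 with hs | rfl | hs
  · simp [rieszSq, hpow, hs, hs.not_gt, hs.ne]
  · simp [rieszSq, neg_div]
  · simp [rieszSq, hpow, hs, hs.not_gt, hs.ne']

theorem rieszSqSlope_inv (s : ℝ) {c : ℝ} (hc : 0 < c) :
    rieszSqSlope (-s) c⁻¹ = rieszSqSlope s c * c ^ 2 := by
  have hpow : c⁻¹ ^ (-s / 2 - 1) = c ^ (s / 2 - 1) * c ^ 2 := by
    rw [Real.inv_rpow hc.le, ← Real.rpow_neg hc.le, ← Real.rpow_natCast c 2,
      ← Real.rpow_add hc]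
    congr 1
    push_cast
    ring
  simp only [rieszSqSlope, neg_eq_zero, abs_neg, hpow, mul_assoc]

theorem one_add_mul_self_le_rpow_one_add_of_nonpos {x p : ℝ} (hx : -1 < x) (hp : p ≤ 0) :
    1 + p * x ≤ (1 + x) ^ p := by
  have hx' : 0 < 1 + x := by linarith
  have hlog := mul_le_mul_of_nonpos_left (Real.log_le_sub_one_of_pos hx') hp
  rw [Real.rpow_def_of_pos hx']
  linarith [Real.add_one_le_exp (Real.log (1 + x) * p)]

theorem rieszSq_le_add_slope_mul {s c t : ℝ} (hs : s ≤ 2) (hc : 0 < c) (ht : 0 < t) :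
    rieszSq s t ≤ rieszSq s c + rieszSqSlope s c * (t - c) := by
  obtain ⟨x, hx, rfl⟩ : ∃ x, -1 < x ∧ t = c * (1 + x) :=
    ⟨t / c - 1, by linarith [div_pos ht hc], by field_simp; ring⟩
  have hx' : 0 < 1 + x := by linarith
  have hslope : c ^ (s / 2 - 1) * (c * (1 + x) - c) = c ^ (s / 2) * x := by
    rw [Real.rpow_sub_one hc.ne']
    field_simp
    ring
  have hcs := Real.rpow_pos_of_pos hc (s / 2)
  rw [rieszSqSlope, mul_assoc, hslope]
  rcases lt_trichotomy s 0 with h | rfl | h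
  · simp only [rieszSq, h.not_gt, h.ne, if_false, abs_of_neg h, Real.mul_rpow hc.le hx'.le]
    nlinarith [one_add_mul_self_le_rpow_one_add_of_nonpos hx (p := s / 2) (by linarith)]
  · simp only [rieszSq, lt_irrefl, if_false, if_true, Real.log_mul hc.ne' hx'.ne', zero_div,
      Real.rpow_zero]
    linarith [Real.log_le_sub_one_of_pos hx']
  · simp only [rieszSq, h, h.ne', if_true, if_false, abs_of_pos h, Real.mul_rpow hc.le hx'.le]
    nlinarith [rpow_one_add_le_one_add_mul_self hx.le (p := s / 2) (by linarith) (by linarith)]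

theorem add_slope_mul_inv_sub_inv_le_rieszSq {s c t : ℝ} (hs : -2 ≤ s) (hc : 0 < c)
    (ht : 0 < t) :
    rieszSq s c + rieszSqSlope s c * c ^ 2 * (c⁻¹ - t⁻¹) ≤ rieszSq s t := by
  have h := rieszSq_le_add_slope_mul (s := -s) (by linarith) (inv_pos.2 hc) (inv_pos.2 ht)
  rw [rieszSq_inv _ hc, rieszSq_inv _ ht, rieszSqSlope_inv s hc, neg_neg] at h
  linarith

theorem strictMonoOn_rieszSq {s : ℝ} (hs : s ≤ 2) : StrictMonoOn (rieszSq s) (Set.Ioi 0) := by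
  intro c hc t ht hct
  have h := rieszSq_le_add_slope_mul hs ht hc
  nlinarith [rieszSqSlope_pos s ht]

end RieszFunction

section PairValues

/-- The unordered pairs of distinct elements of `X`, over which `pairValues` ranges. -/
def distinctPairs {ι : Type*} [DecidableEq ι] (X : Finset ι) : Finset (Sym2 ι) :=
  X.sym2.filter fun e => ¬ e.IsDiag

/-- The squared distances of the points of a family, as a function of their indices. -/
def normSubSq {ι E : Type*} [NormedAddCommGroup E] (x : ι → E) : SymmFun ι :=
  ⟨fun a b => ‖x a - x b‖ ^ 2, fun _ _ => congrArg (· ^ 2) (norm_sub_rev _ _)⟩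

theorem eq_of_map_eq_of_injOn {α β : Type*} {f : α → β} {I : Set α} (hf : I.InjOn f)
    {A B : Multiset α} (hA : ∀ a ∈ A, a ∈ I) (hB : ∀ b ∈ B, b ∈ I) (h : A.map f = B.map f) :
    A = B := by
  rcases isEmpty_or_nonempty α with _ | _
  · rw [A.eq_zero_of_forall_notMem isEmptyElim, B.eq_zero_of_forall_notMem isEmptyElim]
  have hinv : ∀ C : Multiset α, (∀ c ∈ C, c ∈ I) →
      (C.map f).map (Function.invFunOn f I) = C := fun C hC => by
    rw [Multiset.map_map]
    exact (Multiset.map_congr rfl fun c hc => hf.leftInvOn_invFunOn (hC c hc)).trans C.map_id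
  rw [← hinv A hA, h, hinv B hB]

variable {ι : Type*} [DecidableEq ι]

@[simp]
theorem mk_mem_distinctPairs {X : Finset ι} {a b : ι} :
    s(a, b) ∈ distinctPairs X ↔ (a ∈ X ∧ b ∈ X) ∧ a ≠ b := by
  simp [distinctPairs]

theorem pairValues_eq_map (ρ : SymmFun ι) (X : Finset ι) :
    pairValues ρ X = (distinctPairs X).val.map (Sym2.lift ρ) := rfl

theorem mem_pairValues {ρ : SymmFun ι} {X : Finset ι} {r : ℝ} :
    r ∈ pairValues ρ X ↔ ∃ a ∈ X, ∃ b ∈ X, a ≠ b ∧ ρ.1 a b = r := by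
  rw [pairValues_eq_map, Multiset.mem_map]
  constructor
  · rintro ⟨e, he, rfl⟩
    induction e with | _ a b
    obtain ⟨⟨ha, hb⟩, hab⟩ := mk_mem_distinctPairs.1 he
    exact ⟨a, ha, b, hb, hab, rfl⟩
  · rintro ⟨a, ha, b, hb, hab, rfl⟩
    exact ⟨s(a, b), mk_mem_distinctPairs.2 ⟨⟨ha, hb⟩, hab⟩, rfl⟩

theorem distinctPairs_image {E : Type*} [DecidableEq E] {x : ι → E} (hx : Function.Injective x)
    (X : Finset ι) : distinctPairs (X.image x) = (distinctPairs X).image (Sym2.map x) := by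
  rw [distinctPairs, Finset.sym2_image, Finset.filter_image]
  simp only [Sym2.isDiag_map hx, distinctPairs]

theorem pairValues_image {E : Type*} [DecidableEq E] {x : ι → E} (hx : Function.Injective x)
    (ρ : SymmFun E) (X : Finset ι) :
    pairValues ρ (X.image x) = pairValues ⟨fun a b => ρ.1 (x a) (x b), fun _ _ => ρ.2 _ _⟩ X := by
  rw [pairValues_eq_map, distinctPairs_image hx,
    Finset.image_val_of_injOn (Sym2.map.injective hx).injOn, Multiset.map_map]
  refine Multiset.map_congr rfl fun e _ => ?_
  induction e with | _ a b
  rfl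

theorem pairValues_rieszFun_image {E : Type*} [NormedAddCommGroup E] [DecidableEq E] {x : ι → E}
    (hx : Function.Injective x) (s : ℝ) (X : Finset ι) :
    pairValues (rieszFun s) (X.image x) = (pairValues (normSubSq x) X).map (rieszSq s) := by
  rw [pairValues_image hx, pairValues_eq_map, pairValues_eq_map, Multiset.map_map]
  refine Multiset.map_congr rfl fun e _ => ?_
  induction e with | _ a b
  exact rieszFun_eq_rieszSq s _ _

theorem sum_offDiag_mk (X : Finset ι) (f : Sym2 ι → ℝ) :
    ∑ p ∈ X.offDiag, f s(p.1, p.2) = 2 * ∑ e ∈ distinctPairs X, f e := by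
  have hmaps : ∀ p ∈ X.offDiag, s(p.1, p.2) ∈ distinctPairs X := fun p hp => by
    rw [Finset.mem_offDiag] at hp
    exact mk_mem_distinctPairs.2 ⟨⟨hp.1, hp.2.1⟩, hp.2.2⟩
  rw [← Finset.sum_fiberwise_of_maps_to hmaps, Finset.mul_sum]
  refine Finset.sum_congr rfl fun e he => ?_
  induction e with | _ a b
  obtain ⟨⟨ha, hb⟩, hab⟩ := mk_mem_distinctPairs.1 he
  have hfiber : (X.offDiag.filter fun p => s(p.1, p.2) = s(a, b)) = {(a, b), (b, a)} := by
    ext ⟨c, d⟩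
    simp only [Finset.mem_filter, Finset.mem_offDiag, Finset.mem_insert, Finset.mem_singleton,
      Sym2.eq_iff, Prod.mk.injEq]
    grind
  rw [hfiber, Finset.sum_pair (by simp [hab]), Sym2.eq_swap, two_mul]

theorem sum_sum_ite_eq_zero [Fintype ι] (f : Sym2 ι → ℝ) :
    ∑ a, ∑ b, (if a = b then 0 else f s(a, b)) = 2 * ∑ e ∈ distinctPairs Finset.univ, f e := by
  rw [← sum_offDiag_mk, ← Fintype.sum_prod_type',
    ← Finset.sum_subset (Finset.subset_univ Finset.univ.offDiag)]
  · exact Finset.sum_congr rfl fun p hp => if_neg (Finset.mem_offDiag.1 hp).2.2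
  · exact fun p _ hp => if_pos (by simpa using hp)

end PairValues

section Equiangular

variable {E ι : Type*} [NormedAddCommGroup E] [InnerProductSpace ℝ E] {v : ι → E} {g : ℝ}

theorem inner_sum_smul_of_inner_eq (hnorm : ∀ j, ‖v j‖ = 1)
    (hinner : ∀ j l, j ≠ l → ⟪v j, v l⟫_ℝ = g) (s : Finset ι) (w : ι → ℝ) {j : ι} (hj : j ∈ s) :
    ⟪∑ l ∈ s, w l • v l, v j⟫_ℝ = (1 - g) * w j + g * ∑ l ∈ s, w l := by
  classical
  have hgram : ∀ l, w l * ⟪v l, v j⟫_ℝ = g * w l + if l = j then (1 - g) * w l else 0 := by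
    intro l
    split_ifs with h
    · rw [h, real_inner_self_eq_norm_sq, hnorm]
      ring
    · rw [hinner l j h]
      ring
  simp only [sum_inner, real_inner_smul_left, hgram, Finset.sum_add_distrib,
    Finset.sum_ite_eq', hj, if_true, Finset.mul_sum]
  ring

theorem affineIndependent_of_inner_eq (hnorm : ∀ j, ‖v j‖ = 1)
    (hinner : ∀ j l, j ≠ l → ⟪v j, v l⟫_ℝ = g) (hg : g ≠ 1) : AffineIndependent ℝ v := by
  rw [affineIndependent_iff]
  intro s w hw hsum j hj
  have h := inner_sum_smul_of_inner_eq hnorm hinner s w hj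
  rw [hsum, inner_zero_left, hw, mul_zero, add_zero] at h
  exact (mul_eq_zero.1 h.symm).resolve_left (sub_ne_zero.2 hg.symm)

theorem inner_eq_of_not_linearIndependent [Fintype ι] (hnorm : ∀ j, ‖v j‖ = 1)
    (hinner : ∀ j l, j ≠ l → ⟪v j, v l⟫_ℝ = g) (hg : g ≠ 1) (hv : ¬ LinearIndependent ℝ v) :
    1 + (Fintype.card ι - 1) * g = 0 := by
  obtain ⟨w, hw, l, hl⟩ := Fintype.not_linearIndependent_iff.1 hv
  have hcoord : ∀ j, (1 - g) * w j + g * ∑ i, w i = 0 := fun j => by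
    rw [← inner_sum_smul_of_inner_eq hnorm hinner _ w (Finset.mem_univ j), hw, inner_zero_left]
  have hW : ∑ i, w i ≠ 0 := fun h₀ => by
    have h := hcoord l
    rw [h₀, mul_zero, add_zero] at h
    exact hl ((mul_eq_zero.1 h).resolve_left (sub_ne_zero.2 hg.symm))
  have htotal : ∑ j, ((1 - g) * w j + g * ∑ i, w i) = 0 :=
    Finset.sum_eq_zero fun j _ => hcoord j
  rw [Finset.sum_add_distrib, ← Finset.mul_sum, Finset.sum_const, Finset.card_univ,
    nsmul_eq_mul] at htotal
  exact mul_left_cancel₀ hW (by linear_combination htotal)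

theorem sum_sum_norm_sub_sq [Fintype ι] (x : ι → E) :
    ∑ a, ∑ b, ‖x a - x b‖ ^ 2 =
      2 * Fintype.card ι * ∑ a, ‖x a‖ ^ 2 - 2 * ‖∑ a, x a‖ ^ 2 := by
  have hsq : ‖∑ a, x a‖ ^ 2 = ∑ a, ∑ b, ⟪x a, x b⟫_ℝ := by
    rw [← real_inner_self_eq_norm_sq, sum_inner]
    simp only [inner_sum]
  rw [hsq]
  simp only [norm_sub_sq_real, Finset.sum_add_distrib, Finset.sum_sub_distrib, Finset.sum_const,
    nsmul_eq_mul, ← Finset.mul_sum, Finset.card_univ]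
  ring

end Equiangular

/-- The vertices of a regular `d`-simplex inscribed in the unit sphere and centred at the origin,
described by their Gram matrix. -/
structure IsUnitSimplex {E : Type*} [NormedAddCommGroup E] [InnerProductSpace ℝ E] {d : ℕ}
    (u : Fin (d + 1) → E) : Prop where
  norm_eq : ∀ j, ‖u j‖ = 1
  inner_eq : ∀ j l, j ≠ l → ⟪u j, u l⟫_ℝ = -1 / d

section UnitSimplex

variable {E F : Type*} [NormedAddCommGroup E] [InnerProductSpace ℝ E] [NormedAddCommGroup F]
  [InnerProductSpace ℝ F] {d : ℕ} {u : Fin (d + 1) → E}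

theorem neg_one_div_natCast_ne_one (d : ℕ) : (-1 / d : ℝ) ≠ 1 := by
  have : (0 : ℝ) ≤ 1 / d := by positivity
  rw [neg_div]
  linarith

namespace IsUnitSimplex

theorem map (hu : IsUnitSimplex u) (f : E →ₗᵢ[ℝ] F) : IsUnitSimplex (f ∘ u) where
  norm_eq j := (f.norm_map _).trans (hu.norm_eq j)
  inner_eq j l hjl := (f.inner_map_map _ _).trans (hu.inner_eq j l hjl)

theorem norm_sub_sq (hu : IsUnitSimplex u) {j l : Fin (d + 1)} (hjl : j ≠ l) :
    ‖u j - u l‖ ^ 2 = 2 + 2 / d := by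
  rw [norm_sub_sq_real, hu.norm_eq, hu.norm_eq, hu.inner_eq j l hjl]
  ring

theorem affineIndependent (hu : IsUnitSimplex u) : AffineIndependent ℝ u :=
  affineIndependent_of_inner_eq hu.norm_eq hu.inner_eq (neg_one_div_natCast_ne_one d)

theorem isRegularSimplex [DecidableEq E] (hu : IsUnitSimplex u) :
    IsRegularSimplex d (Finset.univ.image u) := by
  refine ⟨⟨u, hu.affineIndependent⟩, ⟨Real.sqrt (2 + 2 / d), fun j l hjl => ?_⟩, by simp⟩
  rw [← hu.norm_sub_sq hjl, Real.sqrt_sq (norm_nonneg _), dist_eq_norm]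

theorem sum_eq_zero (hd : 1 ≤ d) (hu : IsUnitSimplex u) : ∑ j, u j = 0 := by
  have hinner : ∀ j, ⟪∑ l, u l, u j⟫_ℝ = 0 := fun j => by
    have h := inner_sum_smul_of_inner_eq hu.norm_eq hu.inner_eq Finset.univ (fun _ => 1)
      (Finset.mem_univ j)
    simp only [one_smul] at h
    rw [h]
    simp only [Finset.sum_const, Finset.card_univ, Fintype.card_fin, nsmul_eq_mul]
    push_cast
    field_simp
    ring
  rw [← inner_self_eq_zero (𝕜 := ℝ), inner_sum]
  exact Finset.sum_eq_zero fun j _ => hinner j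

theorem finrank_span (hd : 1 ≤ d) (hu : IsUnitSimplex u) :
    Module.finrank ℝ (Submodule.span ℝ (Set.range u)) = d := by
  have := FiniteDimensional.span_of_finite ℝ (Set.finite_range u)
  apply le_antisymm
  · have hdep : ¬ LinearIndependent ℝ u := by
      rw [Fintype.not_linearIndependent_iff]
      exact ⟨fun _ => 1, by simpa using hu.sum_eq_zero hd, 0, one_ne_zero⟩
    rw [linearIndependent_iff_card_le_finrank_span, Fintype.card_fin] at hdep
    exact Nat.lt_succ_iff.1 (not_le.1 hdep)
  · refine (hu.affineIndependent.finrank_vectorSpan (Fintype.card_fin _)).ge.trans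
      (Submodule.finrank_mono (Submodule.span_le.2 ?_))
    rintro _ ⟨x, hx, y, hy, rfl⟩
    exact sub_mem (Submodule.subset_span hx) (Submodule.subset_span hy)

theorem of_equilateral (hd : 1 ≤ d) {σ : Affine.Simplex ℝ E d} (hσ : σ.Equilateral)
    {L : Submodule ℝ E} (hL : Module.finrank ℝ L = d) (hmem : ∀ j, σ.points j ∈ L)
    (hnorm : ∀ j, ‖σ.points j‖ = 1) : IsUnitSimplex σ.points := by
  have : FiniteDimensional ℝ L := FiniteDimensional.of_finrank_pos (by omega)
  obtain ⟨r, hr⟩ := hσ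
  have hinner : ∀ j l, j ≠ l → ⟪σ.points j, σ.points l⟫_ℝ = 1 - r ^ 2 / 2 := fun j l hjl => by
    have h := norm_sub_sq_real (σ.points j) (σ.points l)
    rw [← dist_eq_norm, hr j l hjl, hnorm, hnorm] at h
    linarith
  have hr₀ : r ≠ 0 := by
    have h01 : (0 : Fin (d + 1)) ≠ Fin.last d := Fin.ne_of_lt (Fin.mk_lt_mk.2 hd)
    rw [← hr _ _ h01]
    exact dist_ne_zero.2 (σ.independent.injective.ne h01)
  have hdep : ¬ LinearIndependent ℝ σ.points := fun h => by
    have hL' : LinearIndependent ℝ fun j => (⟨σ.points j, hmem j⟩ : L) :=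
      .of_comp L.subtype h
    simpa [hL] using hL'.fintype_card_le_finrank
  have hg := inner_eq_of_not_linearIndependent hnorm hinner (by simpa using hr₀) hdep
  refine ⟨hnorm, fun j l hjl => ?_⟩
  rw [hinner j l hjl]
  simp only [Fintype.card_fin, Nat.cast_add, Nat.cast_one, add_sub_cancel_right] at hg
  field_simp
  linarith

end IsUnitSimplex

theorem sum_sum_regular_sub_norm_sub_sq (hd : 1 ≤ d) (v : Fin (d + 1) → E) :
    ∑ j, ∑ l, (if j = l then 0 else 2 + 2 / (d : ℝ) - ‖v j - v l‖ ^ 2) =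
      2 * (d + 1) * ∑ j, (1 - ‖v j‖ ^ 2) + 2 * ‖∑ j, v j‖ ^ 2 := by
  have hterm : ∀ j l, (if j = l then 0 else 2 + 2 / (d : ℝ) - ‖v j - v l‖ ^ 2) =
      2 + 2 / (d : ℝ) - ‖v j - v l‖ ^ 2 - if j = l then 2 + 2 / (d : ℝ) else 0 := by
    intro j l
    split_ifs with h <;> simp [h]
  simp only [hterm, Finset.sum_sub_distrib, sum_sum_norm_sub_sq, Finset.sum_ite_eq,
    Finset.mem_univ, if_true, Finset.sum_const, Finset.card_univ, Fintype.card_fin, nsmul_eq_mul]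
  push_cast
  field_simp
  ring

theorem IsUnitSimplex.of_norm_sub_sq (hd : 1 ≤ d) (hu : ∀ j, ‖u j‖ ≤ 1)
    (h : ∀ j l, j ≠ l → ‖u j - u l‖ ^ 2 = 2 + 2 / d) : IsUnitSimplex u := by
  have hsq : ∀ j ∈ Finset.univ, 0 ≤ 1 - ‖u j‖ ^ 2 := fun j _ =>
    sub_nonneg.2 (pow_le_one₀ (norm_nonneg _) (hu j))
  have hblock := sum_sum_regular_sub_norm_sub_sq hd u
  have hzero : ∑ j, ∑ l, (if j = l then 0 else 2 + 2 / (d : ℝ) - ‖u j - u l‖ ^ 2) = 0 :=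
    Finset.sum_eq_zero fun j _ => Finset.sum_eq_zero fun l _ => by
      split_ifs with hjl
      exacts [rfl, sub_eq_zero.2 (h j l hjl).symm]
  have hsum : ∑ j, (1 - ‖u j‖ ^ 2) = 0 :=
    le_antisymm (by rw [hzero] at hblock; nlinarith [sq_nonneg ‖∑ j, u j‖])
      (Finset.sum_nonneg hsq)
  have hnorm : ∀ j, ‖u j‖ = 1 := fun j => by
    have := (Finset.sum_eq_zero_iff_of_nonneg hsq).1 hsum j (Finset.mem_univ j)
    exact (sq_eq_sq₀ (norm_nonneg _) zero_le_one).1 (by linarith)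
  refine ⟨hnorm, fun j l hjl => ?_⟩
  have := h j l hjl
  rw [norm_sub_sq_real, hnorm, hnorm] at this
  rw [neg_div]
  linear_combination (-1 / 2 : ℝ) * this

theorem isUnitSimplex_of_orthonormal (hd : 1 ≤ d) {e : Fin (d + 1) → E} (he : Orthonormal ℝ e) :
    IsUnitSimplex fun j => Real.sqrt ((d + 1) / d) • (e j - (d + 1 : ℝ)⁻¹ • ∑ i, e i) := by
  have hee : ∀ j l, ⟪e j, e l⟫_ℝ = if j = l then 1 else 0 := orthonormal_iff_ite.1 he
  have hgram : ∀ j l, ⟪e j - (d + 1 : ℝ)⁻¹ • ∑ i, e i, e l - (d + 1 : ℝ)⁻¹ • ∑ i, e i⟫_ℝ =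
      (if j = l then 1 else 0) - (d + 1 : ℝ)⁻¹ := fun j l => by
    simp only [inner_sub_left, inner_sub_right, real_inner_smul_left, real_inner_smul_right,
      sum_inner, inner_sum, hee, Finset.sum_ite_eq, Finset.sum_ite_eq', Finset.mem_univ, if_true,
      Finset.sum_const, Finset.card_univ, Fintype.card_fin, nsmul_eq_mul]
    push_cast
    field_simp
    ring
  have hscale : Real.sqrt ((d + 1) / d) * Real.sqrt ((d + 1) / d) = (d + 1) / d :=
    Real.mul_self_sqrt (by positivity)
  constructor
  · intro j
    rw [← sq_eq_sq₀ (norm_nonneg _) zero_le_one, ← real_inner_self_eq_norm_sq,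
      real_inner_smul_left, real_inner_smul_right, ← mul_assoc, hscale, hgram, if_pos rfl]
    field_simp
    ring
  · intro j l hjl
    rw [real_inner_smul_left, real_inner_smul_right, ← mul_assoc, hscale, hgram, if_neg hjl]
    field_simp
    ring

theorem exists_isUnitSimplex (hd : 1 ≤ d) (hE : Module.finrank ℝ E = d) :
    ∃ u : Fin (d + 1) → E, IsUnitSimplex u := by
  have : FiniteDimensional ℝ E := FiniteDimensional.of_finrank_pos (by omega)
  have hu := isUnitSimplex_of_orthonormal hd
    (EuclideanSpace.basisFun (Fin (d + 1)) ℝ).orthonormal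
  set u := fun j => Real.sqrt ((d + 1) / d) • (EuclideanSpace.basisFun (Fin (d + 1)) ℝ j -
    (d + 1 : ℝ)⁻¹ • ∑ i, EuclideanSpace.basisFun (Fin (d + 1)) ℝ i)
  let U := Submodule.span ℝ (Set.range u)
  have huU : IsUnitSimplex fun j => (⟨u j, Submodule.subset_span ⟨j, rfl⟩⟩ : U) :=
    ⟨hu.norm_eq, hu.inner_eq⟩
  have hrank : Module.finrank ℝ U = Module.finrank ℝ E := by rw [hu.finrank_span hd, hE]
  exact ⟨_, huU.map ((stdOrthonormalBasis ℝ U).equiv (stdOrthonormalBasis ℝ E)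
    (finCongr hrank)).toLinearIsometry⟩

end UnitSimplex

/-- The index set of the vertices of simplices of dimensions `d i`: the pair `⟨i, j⟩` stands for
the `j`-th vertex of the `i`-th simplex. -/
abbrev VertexIndex {κ : Type*} (d : κ → ℕ) : Type _ := Σ i, Fin (d i + 1)

/-- The squared distances in a union of mutually orthogonal regular simplices of dimensions `d i`
inscribed in the unit sphere: `2 + 2 / d i` within a simplex, `2` between simplices. The value on
the diagonal is irrelevant. -/
noncomputable def simplexDistSq {κ : Type*} [DecidableEq κ] (d : κ → ℕ) :
    SymmFun (VertexIndex d) :=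
  ⟨fun a b => if a.1 = b.1 then 2 + 2 / d a.1 else 2, fun a b => by grind⟩

/-- The vertices of mutually orthogonal regular simplices, inscribed in the unit sphere and centred
at the origin: the parametrized form of `IsOrthogonalSimplexUnion`. -/
structure IsOrthogonalSimplexFamily {κ E : Type*} [NormedAddCommGroup E] [InnerProductSpace ℝ E]
    {d : κ → ℕ} (v : VertexIndex d → E) : Prop where
  isUnitSimplex : ∀ i, IsUnitSimplex fun j => v ⟨i, j⟩
  inner_eq_zero : ∀ a b, a.1 ≠ b.1 → ⟪v a, v b⟫_ℝ = 0

section SimplexFamily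

variable {κ E : Type*} [NormedAddCommGroup E] [InnerProductSpace ℝ E] {d : κ → ℕ}
  {v : VertexIndex d → E}

theorem two_le_simplexDistSq [DecidableEq κ] (d : κ → ℕ) (a b : VertexIndex d) :
    2 ≤ (simplexDistSq d).1 a b := by
  have : (0 : ℝ) ≤ 2 / d a.1 := by positivity
  dsimp only [simplexDistSq]
  split_ifs <;> linarith

theorem simplexDistSq_le_four [DecidableEq κ] (hd : ∀ i, 1 ≤ d i) (a b : VertexIndex d) :
    (simplexDistSq d).1 a b ≤ 4 := by
  have hda : (1 : ℝ) ≤ d a.1 := by exact_mod_cast hd a.1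
  have : 2 / (d a.1 : ℝ) ≤ 2 := div_le_self zero_le_two hda
  dsimp only [simplexDistSq]
  split_ifs <;> linarith

theorem mem_Icc_of_mem_pairValues_simplexDistSq [DecidableEq κ] (hd : ∀ i, 1 ≤ d i)
    {X : Finset (VertexIndex d)} {r : ℝ} (hr : r ∈ pairValues (simplexDistSq d) X) :
    r ∈ Set.Icc 2 4 := by
  obtain ⟨a, -, b, -, -, rfl⟩ := mem_pairValues.1 hr
  exact ⟨two_le_simplexDistSq d a b, simplexDistSq_le_four hd a b⟩

namespace IsOrthogonalSimplexFamily

theorem norm_eq (hv : IsOrthogonalSimplexFamily v) (a : VertexIndex d) : ‖v a‖ = 1 :=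
  (hv.isUnitSimplex a.1).norm_eq a.2

theorem norm_sub_sq [DecidableEq κ] (hv : IsOrthogonalSimplexFamily v) {a b : VertexIndex d}
    (hab : a ≠ b) : ‖v a - v b‖ ^ 2 = (simplexDistSq d).1 a b := by
  obtain ⟨i, j⟩ := a
  obtain ⟨i', l⟩ := b
  rcases eq_or_ne i i' with rfl | hi
  · rw [(hv.isUnitSimplex i).norm_sub_sq (by rintro rfl; exact hab rfl)]
    simp [simplexDistSq]
  · rw [norm_sub_sq_real, hv.norm_eq, hv.norm_eq, hv.inner_eq_zero _ _ hi]
    norm_num [simplexDistSq, hi]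

theorem sqrt_two_le_dist (hv : IsOrthogonalSimplexFamily v) {a b : VertexIndex d} (hab : a ≠ b) :
    Real.sqrt 2 ≤ dist (v a) (v b) := by
  classical
  rw [dist_eq_norm]
  refine Real.sqrt_le_iff.2 ⟨norm_nonneg _, ?_⟩
  rw [hv.norm_sub_sq hab]
  exact two_le_simplexDistSq d a b

theorem injective (hv : IsOrthogonalSimplexFamily v) : Function.Injective v := by
  intro a b hab
  by_contra hne
  have h := hv.sqrt_two_le_dist hne
  rw [hab, dist_self] at h
  exact h.not_gt (by positivity)

theorem mem_constrainedSets [Fintype κ] [DecidableEq E] (hv : IsOrthogonalSimplexFamily v) :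
    Finset.univ.image v ∈
      constrainedSets (Metric.sphere (0 : E) 1) (Real.sqrt 2) (∑ i, d i + Fintype.card κ) := by
  refine ⟨?_, ?_, ?_⟩
  · simpa [Set.range_subset_iff] using hv.norm_eq
  · rw [Finset.card_image_of_injective _ hv.injective]
    simp [Finset.sum_add_distrib]
  · simp only [Finset.mem_image, Finset.mem_univ, true_and, forall_exists_index,
      forall_apply_eq_imp_iff]
    exact fun a b hab => hv.sqrt_two_le_dist fun h => hab (congrArg v h)

theorem pairValues_rieszFun [Fintype κ] [DecidableEq κ] [DecidableEq E]
    (hv : IsOrthogonalSimplexFamily v) (s : ℝ) :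
    pairValues (rieszFun s) (Finset.univ.image v) =
      (pairValues (simplexDistSq d) Finset.univ).map (rieszSq s) := by
  rw [pairValues_rieszFun_image hv.injective]
  refine congrArg (Multiset.map (rieszSq s)) (Multiset.map_congr rfl fun e he => ?_)
  induction e with | _ a b
  exact hv.norm_sub_sq (mk_mem_distinctPairs.1 he).2

theorem of_norm_sub_sq [DecidableEq κ] (hd : ∀ i, 1 ≤ d i) (hnorm : ∀ a, ‖v a‖ ≤ 1)
    (h : ∀ a b, a ≠ b → ‖v a - v b‖ ^ 2 = (simplexDistSq d).1 a b) :
    IsOrthogonalSimplexFamily v := by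
  have hunit : ∀ i, IsUnitSimplex fun j => v ⟨i, j⟩ := fun i =>
    .of_norm_sub_sq (hd i) (fun j => hnorm ⟨i, j⟩) fun j l hjl => by
      rw [h _ _ (by simpa using hjl)]
      simp [simplexDistSq]
  refine ⟨hunit, fun a b hab => ?_⟩
  have hdist := h a b fun h => hab (congrArg Sigma.fst h)
  rw [norm_sub_sq_real, show ‖v a‖ = 1 from (hunit a.1).norm_eq a.2,
    show ‖v b‖ = 1 from (hunit b.1).norm_eq b.2] at hdist
  simp only [simplexDistSq, hab, if_false] at hdist
  linarith

theorem isOrthogonalSimplexUnion {n k : ℕ} {d : Fin k → ℕ} {v : VertexIndex d → E}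
    [DecidableEq E] (hd : ∀ i, 1 ≤ d i) (hn : ∑ i, d i = n) (hv : IsOrthogonalSimplexFamily v) :
    IsOrthogonalSimplexUnion n k (Finset.univ.image v) := by
  refine ⟨d, fun i => Submodule.span ℝ (Set.range fun j => v ⟨i, j⟩),
    fun i => Finset.univ.image fun j => v ⟨i, j⟩, hd, hn,
    fun i => (hv.isUnitSimplex i).finrank_span (hd i), fun i j hij => ?_,
    fun i => (hv.isUnitSimplex i).isRegularSimplex, fun i x hx => ?_, ?_⟩
  · rw [Submodule.isOrtho_span]
    rintro _ ⟨a, rfl⟩ _ ⟨b, rfl⟩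
    exact hv.inner_eq_zero _ _ hij
  · obtain ⟨j, -, rfl⟩ := Finset.mem_image.1 hx
    exact ⟨Submodule.subset_span ⟨j, rfl⟩, hv.norm_eq _⟩
  · ext x
    simp [Sigma.exists]

end IsOrthogonalSimplexFamily

theorem IsOrthogonalSimplexUnion.exists_family [DecidableEq E] {n k : ℕ} {X : Finset E}
    (hX : IsOrthogonalSimplexUnion n k X) :
    ∃ d : Fin k → ℕ, (∀ i, 1 ≤ d i) ∧ ∑ i, d i = n ∧
      ∃ v : VertexIndex d → E, IsOrthogonalSimplexFamily v ∧ X = Finset.univ.image v := by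
  obtain ⟨d, L, S, hd, hn, hrank, hortho, hreg, hmem, hXS⟩ := hX
  choose σ hσ hrange using hreg
  have hvert : ∀ i j, (σ i).points j ∈ S i := fun i j => by
    rw [← Finset.mem_coe, ← hrange i]
    exact ⟨j, rfl⟩
  refine ⟨d, hd, hn, fun a => (σ a.1).points a.2, ⟨fun i => ?_, fun a b hab => ?_⟩, ?_⟩
  · exact .of_equilateral (hd i) (hσ i) (hrank i) (fun j => (hmem i _ (hvert i j)).1)
      fun j => (hmem i _ (hvert i j)).2
  · exact (hortho _ _ hab).inner_eq (hmem _ _ (hvert a.1 a.2)).1 (hmem _ _ (hvert b.1 b.2)).1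
  · rw [← Finset.coe_inj, hXS]
    ext x
    simp [← hrange, Sigma.exists]

variable [Fintype κ] [DecidableEq κ]

theorem sum_sum_ite_fst_eq (F : VertexIndex d → VertexIndex d → ℝ) :
    ∑ a, ∑ b, (if a.1 = b.1 then F a b else 0) = ∑ i, ∑ j, ∑ l, F ⟨i, j⟩ ⟨i, l⟩ := by
  simp only [Fintype.sum_sigma]
  refine Finset.sum_congr rfl fun i _ => Finset.sum_congr rfl fun j _ => ?_
  rw [Finset.sum_eq_single i (fun i' _ hi' => by simp [hi'.symm]) (by simp)]
  simp

theorem sum_sum_weighted_simplexDistSq_sub_nonneg (hd : ∀ i, 1 ≤ d i)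
    (hnorm : ∀ a, ‖v a‖ ≤ 1) (hortho : ∀ a b, a.1 ≠ b.1 → ⟪v a, v b⟫_ℝ = 0) {w : ℝ → ℝ}
    (hw : ∀ a b : VertexIndex d, a ≠ b → 0 ≤ w ((simplexDistSq d).1 a b)) :
    0 ≤ ∑ a : VertexIndex d, ∑ b : VertexIndex d, if a = b then 0 else
      w ((simplexDistSq d).1 a b) * ((simplexDistSq d).1 a b - ‖v a - v b‖ ^ 2) := by
  let F (a b : VertexIndex d) : ℝ := if a = b then 0 else
    w ((simplexDistSq d).1 a b) * ((simplexDistSq d).1 a b - ‖v a - v b‖ ^ 2)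
  have hsq : ∀ a, ‖v a‖ ^ 2 ≤ 1 := fun a => pow_le_one₀ (norm_nonneg _) (hnorm a)
  have hcross : ∀ a b, a.1 ≠ b.1 → 0 ≤ F a b := fun a b hab => by
    have hne : a ≠ b := fun h => hab (congrArg Sigma.fst h)
    dsimp only [F]
    rw [if_neg hne]
    refine mul_nonneg (hw a b hne) ?_
    rw [norm_sub_sq_real, hortho a b hab]
    linarith [two_le_simplexDistSq d a b, hsq a, hsq b]
  have hblock : ∀ i, 0 ≤ ∑ j, ∑ l, F ⟨i, j⟩ ⟨i, l⟩ := fun i => by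
    have hF : ∀ j l, F ⟨i, j⟩ ⟨i, l⟩ = w (2 + 2 / d i) *
        if j = l then 0 else 2 + 2 / (d i : ℝ) - ‖v ⟨i, j⟩ - v ⟨i, l⟩‖ ^ 2 := fun j l => by
      by_cases hjl : j = l <;> simp [F, simplexDistSq, hjl]
    have h01 : (0 : Fin (d i + 1)) ≠ Fin.last (d i) := Fin.ne_of_lt (Fin.mk_lt_mk.2 (hd i))
    have hwi : 0 ≤ w (2 + 2 / d i) := by
      simpa [simplexDistSq] using hw ⟨i, 0⟩ ⟨i, Fin.last _⟩ (by simpa using h01)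
    simp only [hF, ← Finset.mul_sum, sum_sum_regular_sub_norm_sub_sq (hd i)]
    have := Finset.sum_nonneg fun j (_ : j ∈ Finset.univ) => sub_nonneg.2 (hsq ⟨i, j⟩)
    positivity
  calc (0 : ℝ) ≤ ∑ i, ∑ j, ∑ l, F ⟨i, j⟩ ⟨i, l⟩ := Finset.sum_nonneg fun i _ => hblock i
    _ = ∑ a, ∑ b, (if a.1 = b.1 then F a b else 0) := (sum_sum_ite_fst_eq F).symm
    _ ≤ ∑ a, ∑ b, F a b := Finset.sum_le_sum fun a _ => Finset.sum_le_sum fun b _ => by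
      split_ifs with hab
      exacts [le_rfl, hcross a b hab]

theorem weighted_sum_simplexDistSq_sub_nonneg (hd : ∀ i, 1 ≤ d i)
    (hnorm : ∀ a, ‖v a‖ ≤ 1) (hortho : ∀ a b, a.1 ≠ b.1 → ⟪v a, v b⟫_ℝ = 0) {w : ℝ → ℝ}
    (hw : ∀ e ∈ distinctPairs (Finset.univ : Finset (VertexIndex d)),
      0 ≤ w (Sym2.lift (simplexDistSq d) e)) :
    0 ≤ ∑ e ∈ distinctPairs (Finset.univ : Finset (VertexIndex d)),
      w (Sym2.lift (simplexDistSq d) e) *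
        (Sym2.lift (simplexDistSq d) e - Sym2.lift (normSubSq v) e) := by
  have hsum := sum_sum_weighted_simplexDistSq_sub_nonneg hd hnorm hortho fun a b hab =>
    hw s(a, b) (mk_mem_distinctPairs.2 ⟨⟨Finset.mem_univ a, Finset.mem_univ b⟩, hab⟩)
  have hpairs := sum_sum_ite_eq_zero fun e : Sym2 (VertexIndex d) =>
    w (Sym2.lift (simplexDistSq d) e) *
      (Sym2.lift (simplexDistSq d) e - Sym2.lift (normSubSq v) e)
  exact nonneg_of_mul_nonneg_right (hsum.trans_eq hpairs) two_pos

end SimplexFamily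

section ConservedSums

variable {κ : Type*} [Fintype κ] [DecidableEq κ] {d : κ → ℕ}

theorem sum_sum_map_simplexDistSq (d : κ → ℕ) (h : ℝ → ℝ) :
    ∑ a : VertexIndex d, ∑ b : VertexIndex d, (if a = b then 0 else h ((simplexDistSq d).1 a b)) =
      (∑ i, (d i : ℝ) + Fintype.card κ) ^ 2 * h 2 +
        ∑ i, (d i + 1 : ℝ) * (d i * h (2 + 2 / d i) - (d i + 1) * h 2) := by
  have hsplit : ∀ a b : VertexIndex d, (if a = b then 0 else h ((simplexDistSq d).1 a b)) =
      h 2 + if a.1 = b.1 then (if a = b then -h 2 else h (2 + 2 / d a.1) - h 2) else 0 := by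
    intro a b
    by_cases hab : a = b
    · simp [hab]
    · by_cases hfst : a.1 = b.1 <;> simp [hab, hfst, simplexDistSq]
  have hblock : ∀ i, ∑ j : Fin (d i + 1), ∑ l : Fin (d i + 1),
      (if (⟨i, j⟩ : VertexIndex d) = ⟨i, l⟩ then -h 2 else h (2 + 2 / d i) - h 2) =
        (d i + 1 : ℝ) * (d i * h (2 + 2 / d i) - (d i + 1) * h 2) := by
    intro i
    have hterm : ∀ j l : Fin (d i + 1),
        (if (⟨i, j⟩ : VertexIndex d) = ⟨i, l⟩ then -h 2 else h (2 + 2 / d i) - h 2) =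
          h (2 + 2 / d i) - h 2 - if j = l then h (2 + 2 / d i) else 0 := fun j l => by
      by_cases hjl : j = l <;> simp [hjl]
    simp only [hterm, Finset.sum_sub_distrib, Finset.sum_ite_eq, Finset.mem_univ, if_true,
      Finset.sum_const, Finset.card_univ, Fintype.card_fin, nsmul_eq_mul]
    push_cast
    ring
  simp only [hsplit, Finset.sum_add_distrib, sum_sum_ite_fst_eq, hblock, Finset.sum_const,
    Finset.card_univ, Fintype.card_sigma, Fintype.card_fin, nsmul_eq_mul]
  push_cast
  simp only [mul_one]
  ring

theorem two_mul_sum_map_pairValues_simplexDistSq (d : κ → ℕ) (h : ℝ → ℝ) :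
    2 * ((pairValues (simplexDistSq d) Finset.univ).map h).sum =
      (∑ i, (d i : ℝ) + Fintype.card κ) ^ 2 * h 2 +
        ∑ i, (d i + 1 : ℝ) * (d i * h (2 + 2 / d i) - (d i + 1) * h 2) := by
  rw [← sum_sum_map_simplexDistSq, pairValues_eq_map, Multiset.map_map]
  exact (sum_sum_ite_eq_zero fun e => h (Sym2.lift (simplexDistSq d) e)).symm

theorem sum_pairValues_simplexDistSq (hd : ∀ i, 1 ≤ d i) :
    (pairValues (simplexDistSq d) Finset.univ).sum = (∑ i, (d i : ℝ) + Fintype.card κ) ^ 2 := by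
  have hblock : ∀ i ∈ Finset.univ,
      (d i + 1 : ℝ) * (d i * (2 + 2 / d i) - (d i + 1) * 2) = 0 := fun i _ => by
    have : (d i : ℝ) ≠ 0 := by exact_mod_cast (zero_lt_one.trans_le (hd i)).ne'
    field_simp
    ring
  have h := two_mul_sum_map_pairValues_simplexDistSq d id
  rw [Multiset.map_id] at h
  simp only [id, Finset.sum_eq_zero hblock] at h
  linarith

theorem sum_map_inv_pairValues_simplexDistSq (hd : ∀ i, 1 ≤ d i) :
    ((pairValues (simplexDistSq d) Finset.univ).map (·⁻¹)).sum =
      (∑ i, (d i : ℝ) + Fintype.card κ) ^ 2 / 4 - (∑ i, (d i : ℝ)) / 2 - Fintype.card κ / 4 := by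
  have hblock : ∀ i,
      (d i + 1 : ℝ) * (d i * (2 + 2 / d i : ℝ)⁻¹ - (d i + 1) * 2⁻¹) = -d i - 1 / 2 := fun i => by
    have : (0 : ℝ) < d i := by exact_mod_cast zero_lt_one.trans_le (hd i)
    have : (2 + 2 / d i : ℝ) = 2 * (d i + 1) / d i := by field_simp
    rw [this]
    field_simp
    ring
  have h := two_mul_sum_map_pairValues_simplexDistSq d (·⁻¹)
  simp only [hblock, Finset.sum_sub_distrib, Finset.sum_neg_distrib, Finset.sum_const,
    Finset.card_univ, nsmul_eq_mul] at h
  linarith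

theorem neg_mul_inv_sub_lt_add_mul_rieszSq_sub {s a b K : ℝ} (hs : -2 ≤ s) (ha : 0 < a)
    (hb : 0 < b) (hab : a ≠ b) (hK : a ^ 2 ≤ K) :
    -K * b⁻¹ - b <
      -K * a⁻¹ - a + (K / a ^ 2 - 1) / rieszSqSlope s a * (rieszSq s b - rieszSq s a) := by
  have hslope := rieszSqSlope_pos s ha
  have hratio : 0 ≤ (K / a ^ 2 - 1) / rieszSqSlope s a :=
    div_nonneg (sub_nonneg.2 ((one_le_div (pow_pos ha 2)).2 hK)) hslope.le
  have hsq : 0 < (a - b) ^ 2 / b := div_pos (sq_pos_of_ne_zero (sub_ne_zero.2 hab)) hb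
  calc -K * b⁻¹ - b < -K * b⁻¹ - b + (a - b) ^ 2 / b := lt_add_of_pos_right _ hsq
    _ = -K * a⁻¹ - a + (K / a ^ 2 - 1) / rieszSqSlope s a *
          (rieszSqSlope s a * a ^ 2 * (a⁻¹ - b⁻¹)) := by
      field_simp
      ring
    _ ≤ _ := by
      have := add_slope_mul_inv_sub_inv_le_rieszSq hs ha hb
      gcongr
      linarith

theorem pairValues_simplexDistSq_eq_of_majorizes {s : ℝ} (hs : s ≤ 2) (hs' : -2 ≤ s)
    {d' : κ → ℕ} (hd : ∀ i, 1 ≤ d i) (hd' : ∀ i, 1 ≤ d' i) (hsum : ∑ i, d i = ∑ i, d' i)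
    (h : Majorizes ((pairValues (simplexDistSq d) Finset.univ).map (rieszSq s))
      ((pairValues (simplexDistSq d') Finset.univ).map (rieszSq s))) :
    pairValues (simplexDistSq d) Finset.univ = pairValues (simplexDistSq d') Finset.univ := by
  have hIpos : ∀ t ∈ Set.Icc (2 : ℝ) 4, 0 < t := fun t ht => zero_lt_two.trans_le ht.1
  have hψsum : ∀ A : Multiset ℝ,
      (A.map fun t => -16 * t⁻¹ - t).sum = -16 * (A.map (·⁻¹)).sum - A.sum := fun A => by
    rw [Multiset.sum_map_sub, Multiset.sum_map_mul_left, Multiset.map_id']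
  have hsq : ∀ t ∈ Set.Icc (2 : ℝ) 4, t ^ 2 ≤ 16 := fun t ht => by nlinarith [ht.1, ht.2]
  -- The constant `16` makes the derivative `16 / t ^ 2 - 1` of `ψ` nonnegative on `[2, 4]`.
  refine h.eq_of_sum_map_le (I := Set.Icc 2 4) (ψ := fun t => -16 * t⁻¹ - t)
    (D := fun c => (16 / c ^ 2 - 1) / rieszSqSlope s c)
    ((strictMonoOn_rieszSq hs).mono hIpos)
    (fun _ => mem_Icc_of_mem_pairValues_simplexDistSq hd)
    (fun _ => mem_Icc_of_mem_pairValues_simplexDistSq hd') (fun a ha => ?_)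
    (fun a ha b hb hab => ?_) (le_of_eq ?_)
  · have : 1 ≤ 16 / a ^ 2 := (one_le_div (pow_pos (hIpos a ha) 2)).2 (hsq a ha)
    exact div_nonneg (by linarith) (rieszSqSlope_pos s (hIpos a ha)).le
  · exact neg_mul_inv_sub_lt_add_mul_rieszSq_sub hs' (hIpos a ha) (hIpos b hb) hab (hsq a ha)
  · have hsum' : ∑ i, (d i : ℝ) = ∑ i, (d' i : ℝ) := by exact_mod_cast hsum
    simp only [hψsum, sum_pairValues_simplexDistSq, sum_map_inv_pairValues_simplexDistSq, hd, hd',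
      implies_true, hsum']

end ConservedSums

section Existence

variable {κ E : Type*} [Fintype κ] [NormedAddCommGroup E] [InnerProductSpace ℝ E]
  [FiniteDimensional ℝ E]

theorem exists_orthogonal_submodules {d : κ → ℕ} (hd : ∑ i, d i = Module.finrank ℝ E) :
    ∃ L : κ → Submodule ℝ E,
      (∀ i, Module.finrank ℝ (L i) = d i) ∧ Pairwise fun i j => L i ⟂ L j := by
  obtain ⟨b⟩ : Nonempty (OrthonormalBasis (Σ i, Fin (d i)) ℝ E) :=
    ⟨(stdOrthonormalBasis ℝ E).reindex (Fintype.equivOfCardEq (by simp [hd]))⟩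
  refine ⟨fun i => Submodule.span ℝ (Set.range fun j => b ⟨i, j⟩), fun i => ?_, fun i i' hi => ?_⟩
  · rw [finrank_span_eq_card, Fintype.card_fin]
    exact b.orthonormal.linearIndependent.comp _ sigma_mk_injective
  · refine Submodule.isOrtho_span.2 ?_
    rintro _ ⟨j, rfl⟩ _ ⟨j', rfl⟩
    exact b.orthonormal.2 fun h => hi (congrArg Sigma.fst h)

theorem exists_isOrthogonalSimplexFamily {d : κ → ℕ} (hd : ∀ i, 1 ≤ d i)
    (hsum : ∑ i, d i = Module.finrank ℝ E) :
    ∃ v : VertexIndex d → E, IsOrthogonalSimplexFamily v := by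
  obtain ⟨L, hL, hortho⟩ := exists_orthogonal_submodules hsum
  choose u hu using fun i => exists_isUnitSimplex (hd i) (hL i)
  exact ⟨fun a => u a.1 a.2, fun i => (hu i).map (L i).subtypeₗᵢ,
    fun a b hab => (hortho hab).inner_eq (u a.1 a.2).2 (u b.1 b.2).2⟩

end Existence

theorem exists_one_le_sum_eq {n k : ℕ} (hk : 1 ≤ k) (hkn : k ≤ n) :
    ∃ d : Fin k → ℕ, (∀ i, 1 ≤ d i) ∧ ∑ i, d i = n := by
  refine ⟨fun i => 1 + if i = ⟨0, hk⟩ then n - k else 0, fun i => Nat.le_add_right _ _, ?_⟩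
  simp [Finset.sum_add_distrib]
  omega

section Circuit

variable {K V : Type*} [DivisionRing K] [AddCommGroup V] [Module K V] {A : Finset V}

variable (K) in
/-- A minimal linearly dependent set of vectors, i.e. a circuit of the matroid of linear
independence. -/
def IsLinearCircuit (A : Finset V) : Prop :=
  Minimal (fun B : Finset V => ¬ LinearIndepOn K id (B : Set V)) A

theorem linearIndepOn_id_iff_card_le_finrank_span :
    LinearIndepOn K id (A : Set V) ↔ A.card ≤ Module.finrank K (Submodule.span K (A : Set V)) := by
  rw [LinearIndepOn, linearIndependent_iff_card_le_finrank_span, Set.finrank,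
    ← Set.image_eq_range, Set.image_id]
  simp only [Finset.coe_sort_coe, Fintype.card_coe]

theorem exists_isLinearCircuit_subset
    (hA : Module.finrank K (Submodule.span K (A : Set V)) < A.card) :
    ∃ B ⊆ A, IsLinearCircuit K B :=
  exists_minimal_le_of_wellFoundedLT _ A
    (mt linearIndepOn_id_iff_card_le_finrank_span.1 hA.not_ge)

theorem two_le_card_of_finrank_span_lt_card (h₀ : (0 : V) ∉ A)
    (hA : Module.finrank K (Submodule.span K (A : Set V)) < A.card) : 2 ≤ A.card := by
  obtain ⟨a, ha⟩ : A.Nonempty := Finset.card_pos.1 (by omega)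
  have hpos : 0 < Module.finrank K (Submodule.span K (A : Set V)) :=
    Module.finrank_pos_iff_exists_ne_zero.2 ⟨⟨a, Submodule.subset_span ha⟩, fun h =>
      h₀ ((Submodule.mk_eq_zero _ _).1 h ▸ ha)⟩
  omega

namespace IsLinearCircuit

theorem finrank_span_lt_card (hA : IsLinearCircuit K A) :
    Module.finrank K (Submodule.span K (A : Set V)) < A.card :=
  not_le.1 (mt linearIndepOn_id_iff_card_le_finrank_span.2 hA.prop)

theorem eq_of_subset (hA : IsLinearCircuit K A) {B : Finset V} (hBA : B ⊆ A)
    (hB : ¬ LinearIndepOn K id (B : Set V)) : B = A :=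
  hBA.antisymm (hA.le_of_le hB hBA)

theorem card_le_finrank_span_add_one (hA : IsLinearCircuit K A) :
    A.card ≤ Module.finrank K (Submodule.span K (A : Set V)) + 1 := by
  classical
  obtain ⟨a, ha⟩ : A.Nonempty := Finset.card_pos.1 (Nat.zero_lt_of_lt hA.finrank_span_lt_card)
  have hindep : LinearIndepOn K id (A.erase a : Set V) := by
    by_contra h
    exact (Finset.erase_ssubset ha).ne (hA.eq_of_subset (Finset.erase_subset a A) h)
  have hle := Submodule.finrank_mono (Submodule.span_mono (R := K)
    (Finset.coe_subset.2 (Finset.erase_subset a A)))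
  rw [finrank_span_finset_eq_card hindep, Finset.card_erase_of_mem ha] at hle
  omega

end IsLinearCircuit

end Circuit

section NonposInner

variable {E : Type*} [NormedAddCommGroup E] [InnerProductSpace ℝ E] {A T : Finset E}

theorem sum_filter_pos_smul_eq_zero (hA : ∀ a ∈ A, ∀ b ∈ A, a ≠ b → ⟪a, b⟫_ℝ ≤ 0) {f : E → ℝ}
    (hf : ∑ a ∈ A, f a • a = 0) : ∑ a ∈ A with 0 < f a, f a • a = 0 := by
  have hsplit := Finset.sum_filter_add_sum_filter_not A (fun a => 0 < f a) fun a => f a • a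
  rw [hf] at hsplit
  rw [← real_inner_self_nonpos]
  nth_rewrite 2 [eq_neg_of_add_eq_zero_left hsplit]
  rw [inner_neg_right, sum_inner, neg_nonpos]
  refine Finset.sum_nonneg fun a ha => ?_
  rw [inner_sum]
  refine Finset.sum_nonneg fun b hb => ?_
  rw [Finset.mem_filter] at ha hb
  rw [real_inner_smul_left, real_inner_smul_right]
  have hab : a ≠ b := by rintro rfl; exact hb.2 ha.2
  exact mul_nonneg ha.2.le (mul_nonneg_of_nonpos_of_nonpos (not_lt.1 hb.2)
    (hA a ha.1 b hb.1 hab))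

theorem IsLinearCircuit.exists_pos_sum_smul_eq_zero (hA : IsLinearCircuit ℝ A)
    (hinner : ∀ a ∈ A, ∀ b ∈ A, a ≠ b → ⟪a, b⟫_ℝ ≤ 0) :
    ∃ f : E → ℝ, (∀ a ∈ A, 0 < f a) ∧ ∑ a ∈ A, f a • a = 0 := by
  obtain ⟨f, hf, i, hi, hfi⟩ : ∃ f : E → ℝ, ∑ a ∈ A, f a • a = 0 ∧ ∃ i ∈ A, 0 < f i := by
    have hdep := hA.prop
    simp only [linearIndepOn_finset_iff, id] at hdep
    push Not at hdep
    obtain ⟨f, hf, i, hi, hfi⟩ := hdep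
    rcases hfi.lt_or_gt with h | h
    · exact ⟨-f, by simp [hf], i, hi, by simpa using h⟩
    · exact ⟨f, hf, i, hi, h⟩
  have hP := hA.eq_of_subset (Finset.filter_subset (fun a => 0 < f a) A) fun h =>
    hfi.ne' (linearIndepOn_finset_iff.1 h f (sum_filter_pos_smul_eq_zero hinner hf) i
      (Finset.mem_filter.2 ⟨hi, hfi⟩))
  exact ⟨f, Finset.filter_eq_self.1 hP, hf⟩

theorem inner_eq_zero_of_pos_sum_smul_eq_zero {f : E → ℝ} (hf : ∀ a ∈ A, 0 < f a)
    (hsum : ∑ a ∈ A, f a • a = 0) {b : E} (hb : ∀ a ∈ A, ⟪a, b⟫_ℝ ≤ 0) :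
    ∀ a ∈ A, ⟪a, b⟫_ℝ = 0 := by
  intro a ha
  have hzero : ∑ c ∈ A, f c * ⟪c, b⟫_ℝ = 0 := by
    simp only [← real_inner_smul_left, ← sum_inner, hsum, inner_zero_left]
  have hterm := (Finset.sum_eq_zero_iff_of_nonpos fun c hc =>
    mul_nonpos_of_nonneg_of_nonpos (hf c hc).le (hb c hc)).1 hzero a ha
  exact (mul_eq_zero.1 hterm).resolve_left (hf a ha).ne'

theorem exists_isLinearCircuit_isOrtho_span_sdiff [DecidableEq E]
    (hinner : ∀ a ∈ T, ∀ b ∈ T, a ≠ b → ⟪a, b⟫_ℝ ≤ 0)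
    (hT : Module.finrank ℝ (Submodule.span ℝ (T : Set E)) < T.card) :
    ∃ A ⊆ T, IsLinearCircuit ℝ A ∧
      Submodule.span ℝ (A : Set E) ⟂ Submodule.span ℝ ((T \ A : Finset E) : Set E) := by
  obtain ⟨A, hAT, hA⟩ := exists_isLinearCircuit_subset hT
  obtain ⟨f, hf, hsum⟩ := hA.exists_pos_sum_smul_eq_zero fun a ha b hb =>
    hinner a (hAT ha) b (hAT hb)
  refine ⟨A, hAT, hA, Submodule.isOrtho_span.2 fun a ha b hb => ?_⟩
  obtain ⟨hbT, hbA⟩ := Finset.mem_sdiff.1 hb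
  exact inner_eq_zero_of_pos_sum_smul_eq_zero hf hsum
    (fun c hc => hinner c (hAT hc) b hbT (by rintro rfl; exact hbA hc)) a ha

theorem finrank_span_add_finrank_span_sdiff_le [DecidableEq E] (hAT : A ⊆ T)
    (hA : Submodule.span ℝ (A : Set E) ⟂ Submodule.span ℝ ((T \ A : Finset E) : Set E)) :
    Module.finrank ℝ (Submodule.span ℝ (A : Set E)) +
        Module.finrank ℝ (Submodule.span ℝ ((T \ A : Finset E) : Set E)) ≤
      Module.finrank ℝ (Submodule.span ℝ (T : Set E)) := by
  rw [← Submodule.finrank_sup_add_finrank_inf_eq, hA.disjoint.eq_bot, finrank_bot, add_zero,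
    ← Submodule.span_union]
  exact Submodule.finrank_mono (Submodule.span_mono
    (Set.union_subset (mod_cast hAT) (mod_cast Finset.sdiff_subset)))

theorem exists_orthogonal_coloring {k : ℕ} (h₀ : (0 : E) ∉ T)
    (hinner : ∀ a ∈ T, ∀ b ∈ T, a ≠ b → ⟪a, b⟫_ℝ ≤ 0)
    (hT : Module.finrank ℝ (Submodule.span ℝ (T : Set E)) + (k + 1) ≤ T.card) :
    ∃ β : E → Fin (k + 1), (∀ i, 2 ≤ (T.filter fun a => β a = i).card) ∧
      ∀ a ∈ T, ∀ b ∈ T, β a ≠ β b → ⟪a, b⟫_ℝ = 0 := by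
  classical
  induction k generalizing T with
  | zero =>
    have := two_le_card_of_finrank_span_lt_card h₀ (K := ℝ) (by omega)
    exact ⟨fun _ => 0, fun i => by simpa [Fin.fin_one_eq_zero i], by simp⟩
  | succ k ih =>
    obtain ⟨A, hAT, hA, hortho⟩ := exists_isLinearCircuit_isOrtho_span_sdiff hinner (by omega)
    have hrank := finrank_span_add_finrank_span_sdiff_le hAT hortho
    have hAcard := hA.card_le_finrank_span_add_one
    have hcard := Finset.card_sdiff_add_card_eq_card hAT
    have hsub : T \ A ⊆ T := Finset.sdiff_subset
    obtain ⟨β, hβ, hβortho⟩ := ih (fun h => h₀ (hsub h))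
      (fun a ha b hb => hinner a (hsub ha) b (hsub hb)) (by omega)
    refine ⟨fun a => if a ∈ A then Fin.last (k + 1) else (β a).castSucc, fun i => ?_, ?_⟩
    · cases i using Fin.lastCases with
      | last =>
        refine (two_le_card_of_finrank_span_lt_card (fun h => h₀ (hAT h))
          hA.finrank_span_lt_card).trans (Finset.card_le_card fun a ha => ?_)
        simp [ha, hAT ha]
      | cast i =>
        refine (hβ i).trans (Finset.card_le_card fun a ha => ?_)
        simp only [Finset.mem_filter, Finset.mem_sdiff] at ha
        simp [ha]
    · intro a ha b hb hab
      rw [Submodule.isOrtho_span] at hortho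
      by_cases haA : a ∈ A <;> by_cases hbA : b ∈ A
      · simp [haA, hbA] at hab
      · exact hortho haA (Finset.mem_sdiff.2 ⟨hb, hbA⟩)
      · rw [real_inner_comm]
        exact hortho hbA (Finset.mem_sdiff.2 ⟨ha, haA⟩)
      · simp only [haA, hbA, if_false, ne_eq, Fin.castSucc_inj] at hab
        exact hβortho a (Finset.mem_sdiff.2 ⟨ha, haA⟩) b (Finset.mem_sdiff.2 ⟨hb, hbA⟩) hab

end NonposInner

theorem exists_vertexIndex_equiv {α κ : Type*} [DecidableEq κ] {T : Finset α} {β : α → κ}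
    (hβ : ∀ i, 2 ≤ (T.filter fun a => β a = i).card) :
    ∃ d : κ → ℕ, (∀ i, 1 ≤ d i) ∧ ∃ e : VertexIndex d ≃ T, ∀ a, β (e a) = a.1 := by
  have hcard : ∀ i, Fintype.card {a : T // β a = i} = (T.filter fun a => β a = i).card := fun i =>
    (Fintype.card_congr ((Equiv.subtypeSubtypeEquivSubtypeInter (· ∈ T) (β · = i)).trans
      (Equiv.subtypeEquivRight fun _ => by rw [Finset.mem_filter]))).trans (Fintype.card_coe _)
  let d (i : κ) : ℕ := (T.filter fun a => β a = i).card - 1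
  have hd : ∀ i, d i + 1 = Fintype.card {a : T // β a = i} := fun i =>
    (Nat.sub_add_cancel (one_le_two.trans (hβ i))).trans (hcard i).symm
  refine ⟨d, fun i => Nat.le_sub_of_add_le (hβ i), (Equiv.sigmaCongrRight fun i =>
    (Fintype.equivFinOfCardEq (hd i).symm).symm).trans (Equiv.sigmaFiberEquiv fun a : T => β a),
    fun a => ?_⟩
  exact ((Fintype.equivFinOfCardEq (hd a.1).symm).symm a.2).2

section SqrtTwoSeparated

variable {E : Type*} [NormedAddCommGroup E] {x y : E}

theorem ne_zero_of_sqrt_two_le_dist (hy : ‖y‖ ≤ 1) (h : Real.sqrt 2 ≤ dist x y) : x ≠ 0 := by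
  rintro rfl
  rw [dist_zero_left] at h
  exact (h.trans hy).not_gt (Real.lt_sqrt_of_sq_lt (by norm_num))

variable [InnerProductSpace ℝ E]

theorem inner_nonpos_of_sqrt_two_le_dist (hx : ‖x‖ ≤ 1) (hy : ‖y‖ ≤ 1)
    (h : Real.sqrt 2 ≤ dist x y) : ⟪x, y⟫_ℝ ≤ 0 := by
  rw [dist_eq_norm, Real.sqrt_le_left (norm_nonneg _), norm_sub_sq_real] at h
  linarith [pow_le_one₀ (n := 2) (norm_nonneg x) hx, pow_le_one₀ (n := 2) (norm_nonneg y) hy]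

theorem exists_orthogonal_parametrization [DecidableEq E] {n k : ℕ}
    (hn : Module.finrank ℝ E = n) (hk : 1 ≤ k) (hkn : k ≤ n) {X : Finset E}
    (hX : X ∈ constrainedSets (Metric.closedBall (0 : E) 1) (Real.sqrt 2) (n + k)) :
    ∃ d : Fin k → ℕ, (∀ i, 1 ≤ d i) ∧ ∑ i, d i = n ∧ ∃ v : VertexIndex d → E,
      Function.Injective v ∧ X = Finset.univ.image v ∧ (∀ a, ‖v a‖ ≤ 1) ∧
        ∀ a b, a.1 ≠ b.1 → ⟪v a, v b⟫_ℝ = 0 := by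
  have : FiniteDimensional ℝ E := .of_finrank_pos (by omega)
  obtain ⟨hball, hcard, hdist⟩ := hX
  have hnorm : ∀ x ∈ X, ‖x‖ ≤ 1 := fun x hx => mem_closedBall_zero_iff.1 (hball hx)
  obtain ⟨k, rfl⟩ : ∃ l, k = l + 1 := ⟨k - 1, by omega⟩
  have h₀ : (0 : E) ∉ X := fun h => by
    obtain ⟨y, hy, hne⟩ := Finset.exists_mem_ne (by omega : 1 < X.card) (0 : E)
    exact ne_zero_of_sqrt_two_le_dist (hnorm y hy) (hdist 0 h y hy hne.symm) rfl
  have hrank := (Submodule.span ℝ (X : Set E)).finrank_le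
  obtain ⟨β, hβ, hortho⟩ := exists_orthogonal_coloring (k := k) h₀
    (fun a ha b hb hab => inner_nonpos_of_sqrt_two_le_dist (hnorm a ha) (hnorm b hb)
      (hdist a ha b hb hab)) (by omega)
  obtain ⟨d, hd, e, he⟩ := exists_vertexIndex_equiv hβ
  refine ⟨d, hd, ?_, fun a => e a, Subtype.val_injective.comp e.injective, ?_,
    fun a => hnorm _ (e a).2, fun a b hab => hortho _ (e a).2 _ (e b).2 (by rwa [he, he])⟩
  · have := Fintype.card_congr e
    simp only [Fintype.card_sigma, Fintype.card_fin, Finset.sum_add_distrib, Finset.sum_const,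
      Finset.card_univ, smul_eq_mul, mul_one, Fintype.card_coe, hcard] at this
    omega
  · ext x
    simp only [Finset.mem_image, Finset.mem_univ, true_and]
    exact ⟨fun hx => ⟨e.symm ⟨x, hx⟩, by simp⟩, by rintro ⟨a, rfl⟩; exact (e a).2⟩

end SqrtTwoSeparated

section Comparison

variable {κ E : Type*} [Fintype κ] [DecidableEq κ] [NormedAddCommGroup E] [InnerProductSpace ℝ E]
  {d : κ → ℕ} {v : VertexIndex d → E} {s : ℝ}

theorem majorizes_pairValues_simplexDistSq (hs : s ≤ 2) (hd : ∀ i, 1 ≤ d i)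
    (hv : Function.Injective v) (hnorm : ∀ a, ‖v a‖ ≤ 1)
    (hortho : ∀ a b, a.1 ≠ b.1 → ⟪v a, v b⟫_ℝ = 0) :
    Majorizes ((pairValues (simplexDistSq d) Finset.univ).map (rieszSq s))
      ((pairValues (normSubSq v) Finset.univ).map (rieszSq s)) := by
  have hδ : ∀ e ∈ distinctPairs (Finset.univ : Finset (VertexIndex d)),
      0 < Sym2.lift (simplexDistSq d) e := fun e _ => by
    induction e with | _ a b
    exact zero_lt_two.trans_le (two_le_simplexDistSq d a b)
  refine majorizes_map_of_weighted_sum_nonneg (m := rieszSqSlope s)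
    (fun w hw => weighted_sum_simplexDistSq_sub_nonneg hd hnorm hortho hw)
    (fun e he => (rieszSqSlope_pos s (hδ e he)).le)
    fun e he => rieszSq_le_add_slope_mul hs (hδ e he) ?_
  induction e with | _ a b
  exact pow_pos (norm_pos_iff.2 (sub_ne_zero.2 (hv.ne (mk_mem_distinctPairs.1 he).2))) 2

theorem IsOrthogonalSimplexFamily.of_map_pairValues_eq (hs : s ≤ 2) (hd : ∀ i, 1 ≤ d i)
    (hv : Function.Injective v) (hnorm : ∀ a, ‖v a‖ ≤ 1)
    (hortho : ∀ a b, a.1 ≠ b.1 → ⟪v a, v b⟫_ℝ = 0)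
    (h : (pairValues (simplexDistSq d) Finset.univ).map (rieszSq s) =
      (pairValues (normSubSq v) Finset.univ).map (rieszSq s)) :
    IsOrthogonalSimplexFamily v := by
  have hvalues :
      pairValues (simplexDistSq d) Finset.univ = pairValues (normSubSq v) Finset.univ := by
    refine eq_of_map_eq_of_injOn (strictMonoOn_rieszSq hs).injOn (fun r hr => ?_) (fun r hr => ?_) h
    · exact zero_lt_two.trans_le (mem_Icc_of_mem_pairValues_simplexDistSq hd hr).1
    · obtain ⟨a, -, b, -, hab, rfl⟩ := mem_pairValues.1 hr
      exact pow_pos (norm_pos_iff.2 (sub_ne_zero.2 (hv.ne hab))) 2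
  have hdist := eq_of_map_eq_of_weighted_sum_nonneg
    (fun w hw => weighted_sum_simplexDistSq_sub_nonneg hd hnorm hortho hw) hvalues
  exact .of_norm_sub_sq hd hnorm fun a b hab => hdist s(a, b)
    (mk_mem_distinctPairs.2 ⟨⟨Finset.mem_univ a, Finset.mem_univ b⟩, hab⟩)

end Comparison

section MaximalSets

theorem exists_maximal_majorizes {F : Set (Multiset ℝ)} (hF : F.Finite) (hne : F.Nonempty) :
    ∃ A ∈ F, ∀ B ∈ F, Majorizes B A → B = A := by
  let r (B A : Multiset ℝ) : Prop := Majorizes B A ∧ B ≠ A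
  have : IsStrictOrder (Multiset ℝ) r :=
    { irrefl := fun A h => h.2 rfl
      trans := fun A B C hAB hBC => ⟨hAB.1.trans hBC.1, by
        rintro rfl
        exact hAB.2 (hAB.1.antisymm hBC.1)⟩ }
  obtain ⟨⟨A, hA⟩, -, hmin⟩ :=
    (hF.wellFoundedOn (r := r)).has_min Set.univ ⟨⟨_, hne.some_mem⟩, trivial⟩
  exact ⟨A, hA, fun B hB hBA => by_contra fun hne => hmin ⟨B, hB⟩ trivial ⟨hBA, hne⟩⟩

variable {E : Type*} [MetricSpace E] [DecidableEq E] {S : Set E} {ρ : SymmFun E} {q : ℝ} {m : ℕ}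

theorem mem_MSets_iff {X : Finset E} : X ∈ MSets S ρ q m ↔ X ∈ constrainedSets S q m ∧
    ∀ Y ∈ constrainedSets S q m, Majorizes (pairValues ρ Y) (pairValues ρ X) →
      pairValues ρ Y = pairValues ρ X := by
  refine and_congr_right fun _ => forall₂_congr fun Y _ => ⟨fun h hYX => ?_, fun h => ?_⟩
  · rcases h with hXY | hXY
    exacts [hYX.antisymm hXY, absurd hYX hXY.2]
  · by_cases hYX : Majorizes (pairValues ρ Y) (pairValues ρ X)
    · exact .inl (h hYX ▸ .refl _)
    · exact (em _).imp_right fun hXY => ⟨hXY, hYX⟩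

theorem MSets_eq_of_dominating {T : Set (Finset E)} (hT : T ⊆ constrainedSets S q m)
    (hdom : ∀ X ∈ constrainedSets S q m, ∃ Y ∈ T, Majorizes (pairValues ρ Y) (pairValues ρ X) ∧
      (pairValues ρ Y = pairValues ρ X → X ∈ T)) :
    MSets S ρ q m = {X ∈ T | ∀ Y ∈ T, Majorizes (pairValues ρ Y) (pairValues ρ X) →
      pairValues ρ Y = pairValues ρ X} := by
  ext X
  rw [mem_MSets_iff]
  constructor
  · rintro ⟨hX, hmax⟩
    obtain ⟨Y, hY, hYX, hXT⟩ := hdom X hX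
    exact ⟨hXT (hmax Y (hT hY) hYX), fun Z hZ => hmax Z (hT hZ)⟩
  · rintro ⟨hX, hmax⟩
    refine ⟨hT hX, fun Z hZ hZX => ?_⟩
    obtain ⟨Y, hY, hYZ, -⟩ := hdom Z hZ
    have hYX := hmax Y hY (hYZ.trans hZX)
    exact Majorizes.antisymm hZX (hYX ▸ hYZ)

end MaximalSets

section SimplexUnions

variable {E : Type*} [NormedAddCommGroup E] [InnerProductSpace ℝ E] {n k : ℕ} {s : ℝ}

theorem IsOrthogonalSimplexUnion.mem_constrainedSets {X : Finset E}
    (hX : IsOrthogonalSimplexUnion n k X) :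
    X ∈ constrainedSets (Metric.sphere (0 : E) 1) (Real.sqrt 2) (n + k) := by
  classical
  obtain ⟨d, -, rfl, v, hv, rfl⟩ := hX.exists_family
  simpa using hv.mem_constrainedSets

theorem exists_isOrthogonalSimplexUnion (hn : Module.finrank ℝ E = n) (hk : 1 ≤ k) (hkn : k ≤ n) :
    ∃ X : Finset E, IsOrthogonalSimplexUnion n k X := by
  classical
  have : FiniteDimensional ℝ E := .of_finrank_pos (by omega)
  obtain ⟨d, hd, hsum⟩ := exists_one_le_sum_eq hk hkn
  obtain ⟨v, hv⟩ := exists_isOrthogonalSimplexFamily hd (hsum.trans hn.symm)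
  exact ⟨_, hv.isOrthogonalSimplexUnion hd hsum⟩

variable [DecidableEq E]

variable (E n k s) in
theorem finite_pairValues_isOrthogonalSimplexUnion :
    (pairValues (rieszFun s) '' {X : Finset E | IsOrthogonalSimplexUnion n k X}).Finite := by
  refine ((Set.finite_Iic fun _ : Fin k => n).image fun d =>
    (pairValues (simplexDistSq d) Finset.univ).map (rieszSq s)).subset ?_
  rintro _ ⟨X, hX, rfl⟩
  obtain ⟨d, -, rfl, v, hv, rfl⟩ := hX.exists_family
  exact ⟨d, fun i => Finset.single_le_sum_of_canonicallyOrdered (Finset.mem_univ i),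
    (hv.pairValues_rieszFun s).symm⟩

theorem exists_isOrthogonalSimplexUnion_majorizes (hn : Module.finrank ℝ E = n) (hk : 1 ≤ k)
    (hkn : k ≤ n) (hs : s ≤ 2) {X : Finset E}
    (hX : X ∈ constrainedSets (Metric.closedBall (0 : E) 1) (Real.sqrt 2) (n + k)) :
    ∃ Y : Finset E, IsOrthogonalSimplexUnion n k Y ∧
      Majorizes (pairValues (rieszFun s) Y) (pairValues (rieszFun s) X) ∧
      (pairValues (rieszFun s) Y = pairValues (rieszFun s) X →
        IsOrthogonalSimplexUnion n k X) := by
  have : FiniteDimensional ℝ E := .of_finrank_pos (by omega)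
  obtain ⟨d, hd, hsum, v, hinj, rfl, hnorm, hortho⟩ :=
    exists_orthogonal_parametrization hn hk hkn hX
  obtain ⟨u, hu⟩ := exists_isOrthogonalSimplexFamily hd (hsum.trans hn.symm)
  refine ⟨_, hu.isOrthogonalSimplexUnion hd hsum, ?_⟩
  rw [hu.pairValues_rieszFun, pairValues_rieszFun_image hinj]
  exact ⟨majorizes_pairValues_simplexDistSq hs hd hinj hnorm hortho, fun h =>
    (IsOrthogonalSimplexFamily.of_map_pairValues_eq hs hd hinj hnorm hortho
      h).isOrthogonalSimplexUnion hd hsum⟩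

theorem IsOrthogonalSimplexUnion.pairValues_eq_of_majorizes (hs : s ≤ 2) (hs' : -2 ≤ s)
    {X Y : Finset E} (hX : IsOrthogonalSimplexUnion n k X) (hY : IsOrthogonalSimplexUnion n k Y)
    (h : Majorizes (pairValues (rieszFun s) X) (pairValues (rieszFun s) Y)) :
    pairValues (rieszFun s) X = pairValues (rieszFun s) Y := by
  obtain ⟨d, hd, hsum, v, hv, rfl⟩ := hX.exists_family
  obtain ⟨d', hd', hsum', v', hv', rfl⟩ := hY.exists_family
  rw [hv.pairValues_rieszFun, hv'.pairValues_rieszFun] at h ⊢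
  rw [pairValues_simplexDistSq_eq_of_majorizes hs hs' hd hd' (hsum.trans hsum'.symm) h]

end SimplexUnions

theorem mainTheorem3_general {E : Type*} [NormedAddCommGroup E] [InnerProductSpace ℝ E]
    [DecidableEq E] {n k : ℕ} (hn : Module.finrank ℝ E = n) (hk : 1 ≤ k) (hkn : k ≤ n) {s : ℝ}
    (hs : s ≤ 2) :
    MSets (Metric.closedBall (0 : E) 1) (rieszFun s) (Real.sqrt 2) (n + k) =
        MSets (Metric.sphere (0 : E) 1) (rieszFun s) (Real.sqrt 2) (n + k) ∧
      (MSets (Metric.sphere (0 : E) 1) (rieszFun s) (Real.sqrt 2) (n + k)).Nonempty ∧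
      (∀ X ∈ MSets (Metric.sphere (0 : E) 1) (rieszFun s) (Real.sqrt 2) (n + k),
        IsOrthogonalSimplexUnion n k X) ∧
      (-2 ≤ s → ∀ X : Finset E, IsOrthogonalSimplexUnion n k X →
        X ∈ MSets (Metric.sphere (0 : E) 1) (rieszFun s) (Real.sqrt 2) (n + k)) := by
  have hsub : constrainedSets (Metric.sphere (0 : E) 1) (Real.sqrt 2) (n + k) ⊆
      constrainedSets (Metric.closedBall (0 : E) 1) (Real.sqrt 2) (n + k) :=
    fun X hX => ⟨hX.1.trans Metric.sphere_subset_closedBall, hX.2⟩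
  have hunion : {X : Finset E | IsOrthogonalSimplexUnion n k X} ⊆
      constrainedSets (Metric.sphere (0 : E) 1) (Real.sqrt 2) (n + k) :=
    fun X hX => hX.mem_constrainedSets
  have hball := MSets_eq_of_dominating (hunion.trans hsub) fun X hX =>
    exists_isOrthogonalSimplexUnion_majorizes hn hk hkn hs hX
  have hsphere := MSets_eq_of_dominating hunion fun X hX =>
    exists_isOrthogonalSimplexUnion_majorizes hn hk hkn hs (hsub hX)
  rw [hball, hsphere]
  refine ⟨rfl, ?_, fun X hX => hX.1, fun hs' X hX => ⟨hX, fun Y hY h =>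
    hY.pairValues_eq_of_majorizes hs hs' hX h⟩⟩
  obtain ⟨_, ⟨X, hX, rfl⟩, hmax⟩ := exists_maximal_majorizes
    (finite_pairValues_isOrthogonalSimplexUnion E n k s)
    (Set.Nonempty.image _ (exists_isOrthogonalSimplexUnion hn hk hkn))
  exact ⟨X, hX, fun Y hY => hmax _ ⟨Y, hY, rfl⟩⟩

open scoped Classical in
theorem mainTheorem3 (n k : ℕ) (hk : 2 ≤ k) (hkn : k ≤ n) (s : ℝ) (hs : s ≤ 2) :
    MSets (Metric.closedBall (0 : EuclideanSpace ℝ (Fin n)) 1) (rieszFun s) (Real.sqrt 2) (n + k) =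
        MSets (Metric.sphere (0 : EuclideanSpace ℝ (Fin n)) 1) (rieszFun s) (Real.sqrt 2) (n + k) ∧
      (MSets (Metric.sphere (0 : EuclideanSpace ℝ (Fin n)) 1) (rieszFun s) (Real.sqrt 2)
        (n + k)).Nonempty ∧
      (∀ X ∈ MSets (Metric.sphere (0 : EuclideanSpace ℝ (Fin n)) 1) (rieszFun s) (Real.sqrt 2)
        (n + k), IsOrthogonalSimplexUnion n k X) ∧
      (-2 ≤ s → ∀ X : Finset (EuclideanSpace ℝ (Fin n)), IsOrthogonalSimplexUnion n k X →
        X ∈ MSets (Metric.sphere (0 : EuclideanSpace ℝ (Fin n)) 1) (rieszFun s) (Real.sqrt 2)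
          (n + k)) :=
  mainTheorem3_general finrank_euclideanSpace_fin (one_le_two.trans hk) hkn hs
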